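/- A *zonotope* in $\mathbb{R}^3$ generated by $u_1,\dots,u_4\in\mathbb{R}^3$ is a set $c+\sum_{i=1}^4[0,u_i]=\{c+\sum_i\lambda_iu_i:\lambda_i\in[0,1]\}$ with $c\in\mathbb{R}^3$. Let $u_1,\dots,u_4\in\mathbb{Z}^3$ be such that every three of them form a basis of $\mathbb{R}^3$. The *volume vector* of these generators is $v=(v_1,\dots,v_4)$, where $v_i=|\det(u_j)_{j\ne i}|$. If the $v_i$ are pairwise distinct, each zonotope $Z=c+\sum_i[0,u_i]$ with $c\in\mathbb{R}^3$ is called a *strong lonely runner (sLR) zonotope* with volume vector $v$. The *covering radius* $\mu(C)$ of a compact convex set $C\subset\mathbb{R}^3$ with non-empty interior is the smallest $\rho>0$ with $\rho C+\mathbb{Z}^3=\mathbb{R}^3$. **Theorem.** Let $v=(v_1,v_2,v_3,v_4)\in\mathbb{Z}^4$ satisfy $1\le v_1<v_2<v_3<v_4$, $\gcd(v_1,v_2,v_3,v_4)=1$ and $v_1+v_2+v_3+v_4\le 195$, and let $Z$ be any sLR zonotope with volume vector $v$. Then $\mu(Z)=\tfrac35$ if and only if $v$ is one of $(1,2,3,4)$,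 $(1,3,4,6)$, $(1,3,4,7)$. Moreover, the following vectors generate sLR zonotopes with these volume vectors (the $i$-th listed vector being $u_i$): 1. $v=(1,2,3,4)$: $(1,-1,1),\ (0,1,1),\ (1,1,-1),\ (-1,-1,0)$; 2. $v=(1,3,4,6)$: $(1,1,2),\ (1,-1,0),\ (-1,-1,1),\ (0,1,-1)$; 3. $v=(1,3,4,7)$: $(1,0,2),\ (1,-1,-2),\ (-1,-1,1),\ (0,1,0)$. -/

import Mathlib

open scoped Pointwise

/-- The zonotope `c + ∑ i, [0, u i]` with translation vector `c` and generators `u i`, as the set of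
all points `c + ∑ i, t i • u i` with `0 ≤ t i ≤ 1`. -/
def zonotope {d n : ℕ} (c : Fin d → ℝ) (u : Fin n → Fin d → ℝ) : Set (Fin d → ℝ) :=
  {x | ∃ t : Fin n → ℝ, (∀ i, t i ∈ Set.Icc (0 : ℝ) 1) ∧ x = c + ∑ i, t i • u i}

/-- An integer vector regarded as a real vector. -/
def intVec {d : ℕ} (z : Fin d → ℤ) : Fin d → ℝ := fun j => (z j : ℝ)

/-- The integer lattice `ℤ^d` inside `ℝ^d`. -/
def intLattice (d : ℕ) : Set (Fin d → ℝ) := Set.range (intVec (d := d))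

/-- The `d + 1` integer vectors `u 0, …, u d` of `ℤ^d` are in linear general position: every `d` of
them form a linear basis of `ℝ^d` (equivalently, as there are `d` of them, are linearly
independent). These are the generators of lonely runner zonotopes. -/
def IsLRGenerators {d : ℕ} (u : Fin (d + 1) → Fin d → ℤ) : Prop :=
  ∀ i : Fin (d + 1), LinearIndependent ℝ (fun j : Fin d => intVec (u (i.succAbove j)))

/-- The volume vector of `d + 1` integer vectors of `ℤ^d`: its `i`-th entry is the absolute value of
the determinant of the vectors other than the `i`-th one. -/
def volumeVector {d : ℕ} (u : Fin (d + 1) → Fin d → ℤ) : Fin (d + 1) → ℤ :=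
  fun i => |(Matrix.of fun j : Fin d => u (i.succAbove j)).det|

/-- Generators of a strong lonely runner zonotope: in linear general position, and the entries of
the volume vector are pairwise distinct. -/
def IsSLRGenerators {d : ℕ} (u : Fin (d + 1) → Fin d → ℤ) : Prop :=
  IsLRGenerators u ∧ Function.Injective (volumeVector u)

/-- `Z` is a strong lonely runner zonotope with volume vector `v`: a translate (by an arbitrary real
vector) of the sum of the segments `[0, u i]` for suitable generators `u`. -/
def IsSLRZonotope {d : ℕ} (v : Fin (d + 1) → ℤ) (Z : Set (Fin d → ℝ)) : Prop :=
  ∃ (c : Fin d → ℝ) (u : Fin (d + 1) → Fin d → ℤ),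
    IsSLRGenerators u ∧ volumeVector u = v ∧ Z = zonotope c (fun i => intVec (u i))

/-- The dilation factors `ρ > 0` for which the integer translates of `ρ C` cover `ℝ^d`. -/
def coveringDilations {d : ℕ} (C : Set (Fin d → ℝ)) : Set ℝ :=
  {ρ | 0 < ρ ∧ ρ • C + intLattice d = Set.univ}

/-- The covering radius of `C`: the smallest `ρ > 0` with `ρ C + ℤ^d = ℝ^d`. For a compact set with
non-empty interior and `d ≥ 1` the infimum is attained, see `isLeast_coveringRadius`. -/
noncomputable def coveringRadius {d : ℕ} (C : Set (Fin d → ℝ)) : ℝ :=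
  sInf (coveringDilations C)

theorem mem_smul_add_intLattice {d : ℕ} {C : Set (Fin d → ℝ)} {ρ : ℝ} {p : Fin d → ℝ} :
    p ∈ ρ • C + intLattice d ↔ ∃ c ∈ C, ∃ z : Fin d → ℤ, p = ρ • c + intVec z := by
  constructor
  · rintro ⟨_, ⟨c, hc, rfl⟩, _, ⟨z, rfl⟩, rfl⟩
    exact ⟨c, hc, z, rfl⟩
  · rintro ⟨c, hc, z, rfl⟩
    exact ⟨_, ⟨c, hc, rfl⟩, _, ⟨z, rfl⟩, rfl⟩

theorem isClosed_intLattice (d : ℕ) : IsClosed (intLattice d) := by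
  have h : intLattice d = ⋂ j : Fin d, (fun x : Fin d → ℝ => x j) ⁻¹' Set.range ((↑) : ℤ → ℝ) := by
    ext x
    simp only [intLattice, Set.mem_range, Set.mem_iInter, Set.mem_preimage]
    constructor
    · rintro ⟨z, rfl⟩ j
      exact ⟨z j, rfl⟩
    · intro hx
      choose z hz using hx
      exact ⟨z, funext hz⟩
  rw [h]
  exact isClosed_iInter fun j =>
    (Int.isClosedEmbedding_coe_real.isClosed_range).preimage (continuous_apply j)

theorem coveringDilations_nonempty {d : ℕ} {C : Set (Fin d → ℝ)} (hi : (interior C).Nonempty) :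
    (coveringDilations C).Nonempty := by
  obtain ⟨x, hx⟩ := hi
  obtain ⟨r, hr, hb⟩ := Metric.isOpen_iff.1 isOpen_interior x hx
  refine ⟨2 / r, by positivity, Set.eq_univ_of_forall fun p => ?_⟩
  rw [mem_smul_add_intLattice]
  set q : Fin d → ℝ := p - (2 / r) • x with hq
  refine ⟨x + (r / 2) • (fun j => Int.fract (q j)), interior_subset (hb ?_), fun j => ⌊q j⌋, ?_⟩
  · rw [Metric.mem_ball, dist_eq_norm, add_sub_cancel_left]
    refine (pi_norm_lt_iff hr).2 fun j => ?_
    have h0 := Int.fract_nonneg (q j)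
    have h1 := Int.fract_lt_one (q j)
    rw [Pi.smul_apply, smul_eq_mul, Real.norm_eq_abs, abs_of_nonneg (by positivity)]
    nlinarith
  · ext j
    have h2 : q j = p j - (2 / r) * x j := by simp [hq]
    have h3 := Int.floor_add_fract (q j)
    simp only [intVec, Pi.add_apply, Pi.smul_apply, smul_eq_mul]
    field_simp
    field_simp at h2
    nlinarith

/-- The covering radius of a compact set with non-empty interior is attained. -/
theorem isLeast_coveringRadius {d : ℕ} (hd : 0 < d) {C : Set (Fin d → ℝ)} (hC : IsCompact C)
    (hi : (interior C).Nonempty) : IsLeast (coveringDilations C) (coveringRadius C) := by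
  have hne := coveringDilations_nonempty hi
  have hbdd : BddBelow (coveringDilations C) := ⟨0, fun ρ hρ => hρ.1.le⟩
  refine ⟨?_, fun ρ hρ => csInf_le hbdd hρ⟩
  obtain ⟨s, -, hs, hsm⟩ := exists_seq_tendsto_sInf hne hbdd
  have key : ∀ p : Fin d → ℝ, ∃ c ∈ C, ∃ z : Fin d → ℤ, p = coveringRadius C • c + intVec z := by
    intro p
    have h1 : ∀ n, ∃ c ∈ C, ∃ z : Fin d → ℤ, p = s n • c + intVec z := fun n =>
      mem_smul_add_intLattice.1 ((hsm n).2 ▸ Set.mem_univ p)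
    choose c hc z hz using h1
    obtain ⟨c₀, hc₀, φ, hφ, hlim⟩ := hC.tendsto_subseq hc
    have h2 : Filter.Tendsto (fun n => p - s (φ n) • c (φ n)) Filter.atTop
        (nhds (p - coveringRadius C • c₀)) :=
      tendsto_const_nhds.sub ((hs.comp hφ.tendsto_atTop).smul hlim)
    have h3 : p - coveringRadius C • c₀ ∈ intLattice d :=
      (isClosed_intLattice d).mem_of_tendsto h2
        (Filter.Eventually.of_forall fun n =>
          ⟨z (φ n), by rw [eq_sub_iff_add_eq, add_comm]; exact (hz (φ n)).symm⟩)
    obtain ⟨w, hw⟩ := h3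
    exact ⟨c₀, hc₀, w, by rw [hw]; abel⟩
  refine ⟨?_, Set.eq_univ_of_forall fun p => mem_smul_add_intLattice.2 (key p)⟩
  refine lt_of_le_of_ne (le_csInf hne fun ρ hρ => hρ.1.le) fun h0 => ?_
  obtain ⟨c, -, z, hz⟩ := key fun _ => 1 / 2
  rw [← h0] at hz
  have h4 := congrFun hz ⟨0, hd⟩
  simp only [zero_smul, zero_add, intVec] at h4
  have h5 : (2 * z ⟨0, hd⟩ : ℝ) = 1 := by linarith
  have h6 : 2 * z ⟨0, hd⟩ = 1 := by exact_mod_cast h5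
  omega

/-! The linear map sending the `i`-th basis vector of ℝ^4 to `u i` has as kernel the line spanned by
the signed maximal minors, whose absolute values are the volume vector. Since the gcd of the minors
is 1, the `u i` generate ℤ^3. Lifting to ℝ^4, the dilate by `ρ` covers modulo ℤ^3 exactly when every
line in direction `v` meets the cube `[0, ρ]^4` modulo ℤ^4 (`mem_coveringDilations_zonotope`). So
the covering radius depends only on `v`, and the question concerns runners with speeds `v i` and
arbitrary starting points.

Finitely many `v` remain. Each one outside the three exceptions is shown to cover already at `599 /
1000`, a convenient rational below `3 / 5`. Most are settled by peeling: if an integer vector nearly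
lies on the line, the line may be replaced by the plane containing both, at the cost of a slightly
smaller box (`CoversMod.peel`). Once a rational hyperplane is reached, the box only has to have
lattice width at least 1 for its primitive normal (`CoversMod.of_functional`). One peel handles
three runners, two handle four. A three-runner certificate with shrunken arcs settles all large
fourth speeds at once (`Covers.snoc_of_window`), and one for reduced speeds settles triples with a
common factor (`Covers.snoc_of_coprime`).

The few remaining vectors are checked on a finite grid of times (`covers_of_grid`). The three
exceptions need a grid argument without rounding loss for covering at `3 / 5`
(`covers_of_refined_grid`), and explicit bad starting points below it (`not_covers_of_grid`). -/

/-- The runners with speeds `v i` have the shifted lonely runner property with target arcs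
`[0, r i]`: for all starting points `s` there is a time at which every runner is in its arc
modulo `1`. -/
def Covers {n : ℕ} (v r : Fin n → ℝ) : Prop :=
  ∀ s : Fin n → ℝ, ∃ (t : ℝ) (z : Fin n → ℤ), ∀ i,
    0 ≤ s i + t * v i + z i ∧ s i + t * v i + z i ≤ r i

theorem Covers.mono {n : ℕ} {v r r' : Fin n → ℝ} (h : Covers v r) (hr : ∀ i, r i ≤ r' i) :
    Covers v r' := fun s =>
  let ⟨t, z, ht⟩ := h s
  ⟨t, z, fun i => ⟨(ht i).1, (ht i).2.trans (hr i)⟩⟩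

theorem Covers.perm {n : ℕ} {v r : Fin n → ℝ} (σ : Equiv.Perm (Fin n))
    (h : Covers (v ∘ σ) (r ∘ σ)) : Covers v r := fun s => by
  obtain ⟨t, z, ht⟩ := h (s ∘ σ)
  refine ⟨t, z ∘ σ.symm, fun i => ?_⟩
  simpa using ht (σ.symm i)

/-- Reflecting `[0, ρ]` about its midpoint reverses the direction of a runner. -/
theorem Covers.of_abs_eq {n : ℕ} {v w : Fin n → ℝ} {ρ : ℝ} (h : Covers v fun _ => ρ)
    (hvw : ∀ i, |w i| = |v i|) : Covers w fun _ => ρ := fun s => by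
  obtain ⟨t, z, ht⟩ := h fun i => if w i = v i then s i else ρ - s i
  refine ⟨t, fun i => if w i = v i then z i else - z i, fun i => ?_⟩
  have := ht i
  by_cases hi : w i = v i
  · simpa [hi] using this
  · have h2 : w i = - v i := (abs_eq_abs.1 (hvw i)).resolve_left hi
    simp only [if_neg hi] at this ⊢
    rw [h2]
    push_cast
    constructor <;> linarith

/-! ### From zonotopes to runners -/

section Generators

variable {R : Type*} [CommRing R]

/-- The signed maximal minors of four vectors of length three. -/
def signedMinor (u : Fin 4 → Fin 3 → R) (i : Fin 4) : R :=
  (-1) ^ (i : ℕ) * (Matrix.of fun j : Fin 3 => u (i.succAbove j)).det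

/-- Cramer's rule for the three vectors other than `u i`, multiplied by the sign. -/
theorem signedMinor_smul_eq (u : Fin 4 → Fin 3 → R) (x : Fin 3 → R) (i : Fin 4) :
    ∃ n : Fin 4 → R, signedMinor u i • x = ∑ k, n k • u k := by
  set A : Matrix (Fin 3) (Fin 3) R := Matrix.of fun j : Fin 3 => u (i.succAbove j) with hA
  have h : Matrix.vecMul (Matrix.vecMul x A.adjugate) A = A.det • x := by
    rw [Matrix.vecMul_vecMul, Matrix.adjugate_mul, Matrix.vecMul_smul, Matrix.vecMul_one]
  refine ⟨i.insertNth 0 fun k => (-1) ^ (i : ℕ) * Matrix.vecMul x A.adjugate k, ?_⟩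
  rw [Fin.sum_univ_succAbove _ i]
  simp only [Fin.insertNth_apply_same, zero_smul, zero_add, Fin.insertNth_apply_succAbove]
  rw [signedMinor, mul_smul, ← hA, ← h]
  ext j
  simp only [mul_smul, Pi.smul_apply, smul_eq_mul, Finset.sum_apply, ← Finset.mul_sum]
  rfl

theorem exists_eq_sum_smul {u : Fin 4 → Fin 3 → R} {β : Fin 4 → R}
    (hβ : ∑ i, β i * signedMinor u i = 1) (x : Fin 3 → R) :
    ∃ n : Fin 4 → R, x = ∑ k, n k • u k := by
  choose n hn using signedMinor_smul_eq u x
  refine ⟨fun k => ∑ i, β i * n i k, ?_⟩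
  calc x = ∑ i, β i • (signedMinor u i • x) := by
        conv_lhs => rw [← one_smul R x, ← hβ, Finset.sum_smul]
        simp only [mul_smul]
    _ = ∑ i, ∑ k, (β i * n i k) • u k := by simp [hn, Finset.smul_sum, mul_smul]
    _ = _ := by rw [Finset.sum_comm]; simp [Finset.sum_smul]

theorem sum_signedMinor_smul (u : Fin 4 → Fin 3 → R) : ∑ i, signedMinor u i • u i = 0 := by
  ext j
  simp only [signedMinor, Fin.sum_univ_four, Matrix.det_fin_three, Matrix.of_apply]
  fin_cases j <;> simp [Fin.succAbove, Fin.lt_def] <;> ring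

theorem signedMinor_mul_comm {u : Fin 4 → Fin 3 → R} {a : Fin 4 → R} (ha : ∑ i, a i • u i = 0)
    (i j : Fin 4) : signedMinor u i * a j = signedMinor u j * a i := by
  -- Pairing the relation with the cross product of `u k` and `u l` kills two of its terms and
  -- leaves the proportionality for the other two indices.
  have h : ∀ c, a 0 * u 0 c + a 1 * u 1 c + a 2 * u 2 c + a 3 * u 3 c = 0 := fun c => by
    simpa [Fin.sum_univ_four] using congrFun ha c
  have cross : ∀ k l : Fin 4, ∀ x : Fin 3 → R, x = ∑ i, a i • u i →
      x 0 * (u k 1 * u l 2 - u k 2 * u l 1) + x 1 * (u k 2 * u l 0 - u k 0 * u l 2) +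
        x 2 * (u k 0 * u l 1 - u k 1 * u l 0) = 0 := by
    intro k l x hx
    rw [hx, ha]
    simp
  have c01 := cross 0 1 _ rfl
  have c02 := cross 0 2 _ rfl
  have c03 := cross 0 3 _ rfl
  have c12 := cross 1 2 _ rfl
  have c13 := cross 1 3 _ rfl
  have c23 := cross 2 3 _ rfl
  simp only [Fin.sum_univ_four, Pi.add_apply, Pi.smul_apply, smul_eq_mul] at c01 c02 c03 c12 c13 c23
  have key : ∀ i j : Fin 4, i < j → signedMinor u i * a j = signedMinor u j * a i := by
    intro i j hij
    simp only [signedMinor, Matrix.det_fin_three, Matrix.of_apply]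
    fin_cases i <;> fin_cases j <;> first | exact absurd hij (by decide) | skip
    all_goals simp [Fin.succAbove, Fin.lt_def]
    · linear_combination c23
    · linear_combination -c13
    · linear_combination c12
    · linear_combination c03
    · linear_combination -c02
    · linear_combination c01
  rcases lt_trichotomy i j with hij | rfl | hij
  · exact key i j hij
  · rfl
  · exact (key j i hij).symm

theorem exists_eq_mul_signedMinor {u : Fin 4 → Fin 3 → R} {β : Fin 4 → R}
    (hβ : ∑ i, β i * signedMinor u i = 1) {a : Fin 4 → R} (ha : ∑ i, a i • u i = 0) :
    ∃ t : R, ∀ j, a j = t * signedMinor u j := by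
  refine ⟨∑ i, β i * a i, fun j => ?_⟩
  calc a j = (∑ i, β i * signedMinor u i) * a j := by rw [hβ, one_mul]
    _ = _ := by
      rw [Finset.sum_mul, Finset.sum_mul]
      exact Finset.sum_congr rfl fun i _ => by
        rw [mul_assoc, signedMinor_mul_comm ha i j]; ring

end Generators

theorem exists_sum_mul_eq_one {n : ℕ} {v : Fin n → ℤ} (hv : Finset.univ.gcd v = 1)
    {w : Fin n → ℤ} (hw : ∀ i, |w i| = v i) : ∃ β : Fin n → ℤ, ∑ i, β i * w i = 1 := by
  obtain ⟨g, hg⟩ := Finset.gcd_eq_sum_mul Finset.univ v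
  refine ⟨fun i => g i * (w i).sign, ?_⟩
  rw [← hv, hg]
  refine Finset.sum_congr rfl fun i _ => ?_
  rw [← hw i, mul_assoc, Int.sign_mul_self_eq_abs, mul_comm]

theorem signedMinor_intVec (u : Fin 4 → Fin 3 → ℤ) (i : Fin 4) :
    signedMinor (fun k => intVec (u k)) i = ((signedMinor u i : ℤ) : ℝ) := by
  simp [signedMinor, Matrix.det_fin_three, intVec]

theorem abs_signedMinor (u : Fin 4 → Fin 3 → ℤ) (i : Fin 4) :
    |signedMinor u i| = volumeVector u i := by
  simp [signedMinor, volumeVector, abs_mul]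

/-- Points and lattice vectors of ℝ^3 lift to real and integer combinations of the generators, and
two lifts of a point differ by a multiple of the signed minors. That multiple is the time. -/
theorem mem_coveringDilations_zonotope {u : Fin 4 → Fin 3 → ℤ}
    (hg : Finset.univ.gcd (volumeVector u) = 1) (c : Fin 3 → ℝ) {ρ : ℝ} (hρ : 0 < ρ) :
    ρ ∈ coveringDilations (zonotope c fun i => intVec (u i)) ↔
      Covers (fun i => (volumeVector u i : ℝ)) fun _ => ρ := by
  obtain ⟨β, hβ⟩ := exists_sum_mul_eq_one hg (abs_signedMinor u)
  set U : Fin 4 → Fin 3 → ℝ := fun k => intVec (u k) with hU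
  have hβ' : ∑ i, (β i : ℝ) * signedMinor U i = 1 := by
    simp only [hU, signedMinor_intVec]
    exact_mod_cast hβ
  have habs : ∀ i, |signedMinor U i| = |(volumeVector u i : ℝ)| := fun i => by
    rw [hU, signedMinor_intVec, ← abs_signedMinor]
    push_cast
    rw [abs_abs]
  have hrel := sum_signedMinor_smul U
  have key : (∀ p : Fin 3 → ℝ, ∃ x ∈ zonotope c U, ∃ z : Fin 3 → ℤ, p = ρ • x + intVec z) ↔
      Covers (signedMinor U) fun _ => ρ := by
    constructor
    · intro h s
      obtain ⟨x, ⟨l, hl, rfl⟩, z, hz⟩ := h (ρ • c + ∑ i, s i • U i)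
      obtain ⟨n, hn⟩ := exists_eq_sum_smul hβ z
      have hzU : intVec z = ∑ i, (n i : ℝ) • U i := by
        ext j
        rw [hn]
        simp [intVec, hU]
      have h0 : ∑ i, (ρ * l i + n i - s i) • U i = 0 := by
        rw [hzU, smul_add, add_assoc] at hz
        have := add_left_cancel hz
        simp only [sub_smul, add_smul, Finset.sum_add_distrib, Finset.sum_sub_distrib, mul_smul,
          ← Finset.smul_sum]
        rw [this, sub_self]
      obtain ⟨t, ht⟩ := exists_eq_mul_signedMinor hβ' h0
      refine ⟨t, fun i => - n i, fun i => ?_⟩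
      have h1 : s i + t * signedMinor U i + ((-n i : ℤ) : ℝ) = ρ * l i := by
        rw [← ht i]; push_cast; ring
      have := hl i
      rw [h1]
      exact ⟨mul_nonneg hρ.le this.1, mul_le_of_le_one_right hρ.le this.2⟩
    · intro h p
      obtain ⟨s, hs⟩ := exists_eq_sum_smul hβ' (p - ρ • c)
      obtain ⟨t, n, ht⟩ := h s
      refine ⟨_, ⟨fun i => (s i + t * signedMinor U i + n i) / ρ, fun i =>
        ⟨div_nonneg (ht i).1 hρ.le, (div_le_one hρ).2 (ht i).2⟩, rfl⟩, - ∑ i, n i • u i, ?_⟩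
      have h1 : intVec (- ∑ i, n i • u i) = - ∑ i, (n i : ℝ) • U i := by
        ext j; simp [intVec, hU]
      have h2 : ρ • ∑ i, ((s i + t * signedMinor U i + n i) / ρ) • U i =
          ∑ i, s i • U i + ∑ i, (n i : ℝ) • U i := by
        have : ∑ i, (t * signedMinor U i) • U i = 0 := by
          simp only [mul_smul, ← Finset.smul_sum, hrel, smul_zero]
        rw [Finset.smul_sum, ← add_zero (∑ i, s i • U i), ← this, ← Finset.sum_add_distrib,
          ← Finset.sum_add_distrib]
        refine Finset.sum_congr rfl fun i _ => ?_
        rw [smul_smul, mul_div_cancel₀ _ hρ.ne', add_smul, add_smul]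
      rw [h1, smul_add, h2, ← hs]
      abel
  rw [coveringDilations, Set.mem_ofPred_eq, Set.eq_univ_iff_forall]
  simp only [mem_smul_add_intLattice, hρ, true_and]
  rw [key]
  exact ⟨fun h => h.of_abs_eq fun i => (habs i).symm, fun h => h.of_abs_eq habs⟩

/-! ### Peeling off integer directions -/

section Peeling

variable {n : ℕ}

/-- Every point is congruent to a point of the box `∏ i, [0, r i]` modulo `S + ℤ^n`. -/
def CoversMod (S : Submodule ℝ (Fin n → ℝ)) (r : Fin n → ℝ) : Prop :=
  ∀ s : Fin n → ℝ, ∃ g ∈ S, ∃ z : Fin n → ℤ, ∀ i, 0 ≤ s i + g i + z i ∧ s i + g i + z i ≤ r i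

theorem CoversMod.covers {v r : Fin n → ℝ} (h : CoversMod (Submodule.span ℝ {v}) r) :
    Covers v r := fun s => by
  obtain ⟨g, hg, z, hz⟩ := h s
  obtain ⟨t, rfl⟩ := Submodule.mem_span_singleton.1 hg
  exact ⟨t, z, hz⟩

/-- In a displacement by `β • b`, the integer part of `β` is absorbed by the lattice, and for the
fractional part `b` is replaced by `b - y ∈ S`. The error in coordinate `i` is at most `|y i|`, with
a fixed sign. -/
theorem CoversMod.peel {S : Submodule ℝ (Fin n → ℝ)} {q r y : Fin n → ℝ} (b : Fin n → ℤ)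
    (h : CoversMod (S ⊔ Submodule.span ℝ {intVec b}) q) (hy : intVec b - y ∈ S)
    (hr : ∀ i, q i + |y i| ≤ r i) : CoversMod S r := fun s => by
  -- Shifting by the positive part of `y` in advance keeps the corrected coordinates nonnegative.
  obtain ⟨g, hg, z, hz⟩ := h fun i => s i - max (y i) 0
  obtain ⟨g₀, hg₀, g₁, hg₁, rfl⟩ := Submodule.mem_sup.1 hg
  obtain ⟨β, rfl⟩ := Submodule.mem_span_singleton.1 hg₁
  refine ⟨g₀ + Int.fract β • (intVec b - y), S.add_mem hg₀ (S.smul_mem _ hy), z + ⌊β⌋ • b,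
    fun i => ?_⟩
  have h1 : s i + (g₀ + Int.fract β • (intVec b - y)) i + ((z + ⌊β⌋ • b) i : ℤ) =
      (s i - max (y i) 0 + (g₀ + β • intVec b) i + z i) + (max (y i) 0 - Int.fract β * y i) := by
    have := Int.floor_add_fract β
    simp only [Pi.add_apply, Pi.smul_apply, Pi.sub_apply, smul_eq_mul, intVec, Int.cast_add,
      Int.cast_mul]
    linear_combination (b i : ℝ) * this
  have h2 := hz i
  have h3 := hr i
  have hf0 := Int.fract_nonneg β
  have hf1 := (Int.fract_lt_one β).le
  have h4 : 0 ≤ max (y i) 0 - Int.fract β * y i ∧ max (y i) 0 - Int.fract β * y i ≤ |y i| := by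
    rcases le_total 0 (y i) with hy | hy
    · rw [max_eq_left hy, abs_of_nonneg hy]
      constructor <;> nlinarith
    · rw [max_eq_right hy, abs_of_nonpos hy]
      constructor <;> nlinarith
  rw [h1]
  constructor <;> linarith [h2.1, h2.2, h4.1, h4.2]

/-- The functional `m` maps ℤ^n onto ℤ and the box onto an interval of length at least 1, so every
value of `m` is attained in the box modulo 1. Points with equal values differ by an element of `S`.
-/
theorem CoversMod.of_functional {S : Submodule ℝ (Fin n → ℝ)} {q : Fin n → ℝ} (m c : Fin n → ℤ)
    (hc : ∑ i, m i * c i = 1) (hS : ∀ x : Fin n → ℝ, ∑ i, (m i : ℝ) * x i = 0 → x ∈ S)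
    (hq : ∀ i, 0 ≤ q i) (hw : 1 ≤ ∑ i, |(m i : ℝ)| * q i) : CoversMod S q := fun s => by
  set lo : ℝ := ∑ i, min ((m i : ℝ) * q i) 0 with hlo
  set μ : ℝ := ∑ i, (m i : ℝ) * s i with hμ
  set W : ℝ := ∑ i, |(m i : ℝ)| * q i with hW
  set k : ℤ := ⌈lo - μ⌉ with hk
  set θ : ℝ := (μ + k - lo) / W with hθ
  have hW0 : 0 < W := by linarith
  have hθ0 : 0 ≤ θ := div_nonneg (by linarith [Int.le_ceil (lo - μ)]) hW0.le
  have hθ1 : θ ≤ 1 := (div_le_one hW0).2 (by linarith [Int.ceil_lt_add_one (lo - μ)])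
  have hθW : θ * W = μ + k - lo := div_mul_cancel₀ _ hW0.ne'
  -- `p` lies on the diagonal from the vertex minimizing `m` (value `lo`) to the one maximizing it.
  set p : Fin n → ℝ := fun i => if 0 ≤ m i then θ * q i else (1 - θ) * q i with hp
  have hmp : ∀ i, (m i : ℝ) * p i = min ((m i : ℝ) * q i) 0 + θ * (|(m i : ℝ)| * q i) := by
    intro i
    by_cases h : 0 ≤ m i
    · have h' : (0 : ℝ) ≤ m i := by exact_mod_cast h
      simp only [hp, if_pos h]
      rw [min_eq_right (mul_nonneg h' (hq i)), abs_of_nonneg h']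
      ring
    · have h' : (m i : ℝ) ≤ 0 := by exact_mod_cast (not_le.1 h).le
      simp only [hp, if_neg h]
      rw [min_eq_left (mul_nonpos_of_nonpos_of_nonneg h' (hq i)), abs_of_nonpos h']
      ring
  have hc' : ∑ i, (m i : ℝ) * c i = 1 := by exact_mod_cast hc
  refine ⟨fun i => p i - s i - k * c i, hS _ ?_, fun i => k * c i, fun i => ?_⟩
  · have : ∀ i, (m i : ℝ) * (p i - s i - k * c i) =
        min ((m i : ℝ) * q i) 0 + θ * (|(m i : ℝ)| * q i) - m i * s i - k * (m i * c i) :=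
      fun i => by rw [← hmp]; ring
    simp only [this, Finset.sum_sub_distrib, Finset.sum_add_distrib, ← Finset.mul_sum, hc', ← hlo,
      ← hW, ← hμ, hθW]
    ring
  · have : s i + (p i - s i - k * c i) + ((k * c i : ℤ) : ℝ) = p i := by push_cast; ring
    rw [this]
    have := hq i
    simp only [hp]
    split_ifs
    · constructor <;> nlinarith
    · constructor <;> nlinarith

end Peeling

/-! ### Criteria for three and four runners -/

theorem exists_bezout_three {a b c : ℤ} (h : Nat.gcd (Nat.gcd a.natAbs b.natAbs) c.natAbs = 1) :
    ∃ x y z : ℤ, a * x + b * y + c * z = 1 := by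
  have h1 : Int.gcd (Int.gcd a b) c = 1 := h
  have h2 := Int.gcd_eq_gcd_ab (Int.gcd a b) c
  rw [h1, Int.gcd_eq_gcd_ab a b] at h2
  exact ⟨_, _, _, by rw [← Nat.cast_one (R := ℤ), h2, add_mul, mul_assoc, mul_assoc]⟩

theorem exists_bezout_four {a b c d : ℤ}
    (h : Nat.gcd (Nat.gcd a.natAbs b.natAbs) (Nat.gcd c.natAbs d.natAbs) = 1) :
    ∃ x y z w : ℤ, a * x + b * y + c * z + d * w = 1 := by
  have h1 : Int.gcd (Int.gcd a b) (Int.gcd c d) = 1 := h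
  have h2 := Int.gcd_eq_gcd_ab (Int.gcd a b) (Int.gcd c d)
  rw [h1, Int.gcd_eq_gcd_ab a b, Int.gcd_eq_gcd_ab c d] at h2
  exact ⟨_, _, _, _, by rw [← Nat.cast_one (R := ℤ), h2, add_mul, add_mul,
    mul_assoc, mul_assoc, mul_assoc, mul_assoc, ← add_assoc]⟩

/-- A covering criterion for three runners. The integer vector `(a, b, k)` is approximated by the
positions at time `k / z`. -/
theorem covers_of_planar {x y z a b k : ℤ} {r₁ r₂ r₃ : ℝ} (hz : 0 < z) (m₁ m₂ m₃ : ℤ)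
    (hm₁ : m₁ = k * y - z * b) (hm₂ : m₂ = z * a - k * x) (hm₃ : m₃ = x * b - y * a)
    (hgcd : Nat.gcd (Nat.gcd m₁.natAbs m₂.natAbs) m₃.natAbs = 1)
    (h₁ : |(m₂ : ℝ)| / z ≤ r₁) (h₂ : |(m₁ : ℝ)| / z ≤ r₂) (h₃ : 0 ≤ r₃)
    (hw : 1 ≤ |(m₁ : ℝ)| * (r₁ - |(m₂ : ℝ)| / z) + |(m₂ : ℝ)| * (r₂ - |(m₁ : ℝ)| / z) +
      |(m₃ : ℝ)| * r₃) :
    Covers ![(x : ℝ), y, z] ![r₁, r₂, r₃] := by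
  obtain ⟨c₁, c₂, c₃, hc⟩ := exists_bezout_three hgcd
  have hz' : (0 : ℝ) < z := by exact_mod_cast hz
  have hc' : (m₁ : ℝ) * c₁ + m₂ * c₂ + m₃ * c₃ = 1 := by exact_mod_cast hc
  have e₁ : (m₁ : ℝ) = k * y - z * b := by exact_mod_cast hm₁
  have e₂ : (m₂ : ℝ) = z * a - k * x := by exact_mod_cast hm₂
  have e₃ : (m₃ : ℝ) = x * b - y * a := by exact_mod_cast hm₃
  -- The time `k / z` matches the third coordinate exactly, so only the first two arcs shrink. The
  -- normal of the resulting plane is the cross product `(m₁, m₂, m₃)`.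
  refine CoversMod.covers (CoversMod.peel (y := ![m₂ / z, - m₁ / z, 0])
    (q := ![r₁ - |(m₂ : ℝ)| / z, r₂ - |(m₁ : ℝ)| / z, r₃]) ![a, b, k]
    (CoversMod.of_functional ![m₁, m₂, m₃] ![c₁, c₂, c₃] ?_ ?_ ?_ ?_) ?_ ?_)
  · simpa [Fin.sum_univ_three] using hc
  · intro p hp
    simp only [Fin.sum_univ_three, Matrix.cons_val] at hp
    refine Submodule.mem_sup.2 ⟨_, Submodule.mem_span_singleton.2
      ⟨c₁ * (k * p 1 - b * p 2) + c₂ * (a * p 2 - k * p 0) + c₃ * (b * p 0 - a * p 1), rfl⟩, _,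
      Submodule.mem_span_singleton.2
      ⟨c₁ * (p 2 * y - p 1 * z) + c₂ * (p 0 * z - p 2 * x) + c₃ * (p 1 * x - p 0 * y), rfl⟩, ?_⟩
    rw [e₁, e₂, e₃] at hc' hp
    ext i
    fin_cases i
    · simp [intVec]
      linear_combination (p 0) * hc' - c₁ * hp
    · simp [intVec]
      linear_combination (p 1) * hc' - c₂ * hp
    · simp [intVec]
      linear_combination (p 2) * hc' - c₃ * hp
  · intro i
    fin_cases i
    exacts [sub_nonneg.2 h₁, sub_nonneg.2 h₂, h₃]
  · simpa [Fin.sum_univ_three] using hw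
  · refine Submodule.mem_span_singleton.2 ⟨k / z, ?_⟩
    ext i
    fin_cases i <;> simp [intVec, e₁, e₂] <;> field_simp <;> ring
  · intro i
    fin_cases i <;> simp [abs_div, abs_of_pos hz']

/-- The alternating form on `ℝ^4`, up to sign the determinant. -/
def detForm (v b c x : Fin 4 → ℝ) : ℝ :=
  (v 1 * b 2 * c 3 + v 2 * b 3 * c 1 + v 3 * b 1 * c 2 -
    (v 1 * b 3 * c 2 + v 2 * b 1 * c 3 + v 3 * b 2 * c 1)) * x 0 +
  -(v 0 * b 2 * c 3 + v 2 * b 3 * c 0 + v 3 * b 0 * c 2 -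
    (v 0 * b 3 * c 2 + v 2 * b 0 * c 3 + v 3 * b 2 * c 0)) * x 1 +
  (v 0 * b 1 * c 3 + v 1 * b 3 * c 0 + v 3 * b 0 * c 1 -
    (v 0 * b 3 * c 1 + v 1 * b 0 * c 3 + v 3 * b 1 * c 0)) * x 2 +
  -(v 0 * b 1 * c 2 + v 1 * b 2 * c 0 + v 2 * b 0 * c 1 -
    (v 0 * b 2 * c 1 + v 1 * b 0 * c 2 + v 2 * b 1 * c 0)) * x 3

/-- Cramer's rule: five vectors in ℝ^4 satisfy a relation whose coefficients are determinants. -/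
theorem detForm_smul (v b c d x : Fin 4 → ℝ) :
    detForm v b c d • x = detForm x b c d • v + detForm v x c d • b + detForm v b x d • c +
      detForm v b c x • d := by
  ext i
  fin_cases i <;> simp [detForm] <;> ring

/-- A covering criterion for four runners. The integer vectors `(a₀, a₁, a₂, k)` and
`(c₀, c₁, c₂, l)` are approximated by the positions at the times `k / w` and `l / w`; the `mᵢ` are
the coefficients of the linear relation that they and the speeds satisfy. -/
theorem covers_of_spatial {p q r w a₀ a₁ a₂ k c₀ c₁ c₂ l : ℤ} {ρ : ℝ} (hw : 0 < w)
    (n₀ n₁ n₂ m₀ m₁ m₂ m₃ : ℤ)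
    (hn₀ : n₀ = w * a₀ - k * p) (hn₁ : n₁ = w * a₁ - k * q) (hn₂ : n₂ = w * a₂ - k * r)
    (hm₀ : m₀ = q * a₂ * l + r * k * c₁ + w * a₁ * c₂ - (q * k * c₂ + r * a₁ * l + w * a₂ * c₁))
    (hm₁ : m₁ = -(p * a₂ * l + r * k * c₀ + w * a₀ * c₂ - (p * k * c₂ + r * a₀ * l + w * a₂ * c₀)))
    (hm₂ : m₂ = p * a₁ * l + q * k * c₀ + w * a₀ * c₁ - (p * k * c₁ + q * a₀ * l + w * a₁ * c₀))
    (hm₃ : m₃ =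
      -(p * a₁ * c₂ + q * a₂ * c₀ + r * a₀ * c₁ - (p * a₂ * c₁ + q * a₀ * c₂ + r * a₁ * c₀)))
    (hgcd : Nat.gcd (Nat.gcd m₀.natAbs m₁.natAbs) (Nat.gcd m₂.natAbs m₃.natAbs) = 1)
    (hn : n₀ ≠ 0) (h₀ : |(n₀ : ℝ)| / w ≤ ρ)
    (h₁ : |(n₁ : ℝ)| / w + |(m₂ : ℝ)| / |(n₀ : ℝ)| ≤ ρ)
    (h₂ : |(n₂ : ℝ)| / w + |(m₁ : ℝ)| / |(n₀ : ℝ)| ≤ ρ)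
    (hW : 1 ≤ |(m₀ : ℝ)| * (ρ - |(n₀ : ℝ)| / w) +
      |(m₁ : ℝ)| * (ρ - |(n₁ : ℝ)| / w - |(m₂ : ℝ)| / |(n₀ : ℝ)|) +
      |(m₂ : ℝ)| * (ρ - |(n₂ : ℝ)| / w - |(m₁ : ℝ)| / |(n₀ : ℝ)|) + |(m₃ : ℝ)| * ρ) :
    Covers ![(p : ℝ), q, r, w] fun _ => ρ := by
  obtain ⟨d₀, d₁, d₂, d₃, hd⟩ := exists_bezout_four hgcd
  have hw' : (0 : ℝ) < w := by exact_mod_cast hw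
  have hn' : (n₀ : ℝ) ≠ 0 := by exact_mod_cast hn
  have hρ : 0 ≤ ρ := le_trans (by positivity) h₀
  have hd' : (m₀ : ℝ) * d₀ + m₁ * d₁ + m₂ * d₂ + m₃ * d₃ = 1 := by exact_mod_cast hd
  have f₀ : (n₀ : ℝ) = w * a₀ - k * p := by exact_mod_cast hn₀
  have f₁ : (n₁ : ℝ) = w * a₁ - k * q := by exact_mod_cast hn₁
  have f₂ : (n₂ : ℝ) = w * a₂ - k * r := by exact_mod_cast hn₂
  have e₀ : (m₀ : ℝ) = q * a₂ * l + r * k * c₁ + w * a₁ * c₂ -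
    (q * k * c₂ + r * a₁ * l + w * a₂ * c₁) := by exact_mod_cast hm₀
  have e₁ : (m₁ : ℝ) = -(p * a₂ * l + r * k * c₀ + w * a₀ * c₂ -
    (p * k * c₂ + r * a₀ * l + w * a₂ * c₀)) := by exact_mod_cast hm₁
  have e₂ : (m₂ : ℝ) = p * a₁ * l + q * k * c₀ + w * a₀ * c₁ -
    (p * k * c₁ + q * a₀ * l + w * a₁ * c₀) := by exact_mod_cast hm₂
  have e₃ : (m₃ : ℝ) = -(p * a₁ * c₂ + q * a₂ * c₀ + r * a₀ * c₁ -
    (p * a₂ * c₁ + q * a₀ * c₂ + r * a₁ * c₀)) := by exact_mod_cast hm₃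
  refine CoversMod.covers (CoversMod.peel (y := ![(n₀ : ℝ) / w, n₁ / w, n₂ / w, 0])
    (q := ![ρ - |(n₀ : ℝ)| / w, ρ - |(n₁ : ℝ)| / w, ρ - |(n₂ : ℝ)| / w, ρ]) ![a₀, a₁, a₂, k]
    (CoversMod.peel (y := ![0, (m₂ : ℝ) / n₀, - m₁ / n₀, 0])
    (q := ![ρ - |(n₀ : ℝ)| / w, ρ - |(n₁ : ℝ)| / w - |(m₂ : ℝ)| / |(n₀ : ℝ)|,
      ρ - |(n₂ : ℝ)| / w - |(m₁ : ℝ)| / |(n₀ : ℝ)|, ρ]) ![c₀, c₁, c₂, l]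
    (CoversMod.of_functional ![m₀, m₁, m₂, m₃] ![d₀, d₁, d₂, d₃] ?_ ?_ ?_ ?_) ?_ ?_) ?_ ?_)
  · simpa [Fin.sum_univ_four] using hd
  · intro x hx
    simp only [Fin.sum_univ_four, Matrix.cons_val] at hx
    have h0 : detForm ![p, q, r, w] ![a₀, a₁, a₂, k] ![c₀, c₁, c₂, l] x = 0 := by
      rw [← hx, e₀, e₁, e₂, e₃]
      simp [detForm]
    have h1 : detForm ![(p : ℝ), q, r, w] ![a₀, a₁, a₂, k] ![c₀, c₁, c₂, l] ![d₀, d₁, d₂, d₃] =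
        1 := by
      rw [← hd', e₀, e₁, e₂, e₃]
      simp [detForm]
    have h2 := detForm_smul ![(p : ℝ), q, r, w] ![a₀, a₁, a₂, k] ![c₀, c₁, c₂, l]
      ![d₀, d₁, d₂, d₃] x
    rw [h0, h1, one_smul, zero_smul, add_zero] at h2
    rw [h2]
    refine Submodule.add_mem_sup (Submodule.add_mem_sup ?_ ?_) ?_
    · exact Submodule.smul_mem _ _ (Submodule.mem_span_singleton_self _)
    · refine Submodule.mem_span_singleton.2 ⟨_, congrArg _ ?_⟩
      ext i
      fin_cases i <;> simp [intVec]
    · refine Submodule.mem_span_singleton.2 ⟨_, congrArg _ ?_⟩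
      ext i
      fin_cases i <;> simp [intVec]
  · intro i
    fin_cases i <;> simp <;> linarith
  · simpa [Fin.sum_univ_four] using hW
  -- The two coefficients are chosen to match the last and the zeroth coordinate of the second
  -- integer vector exactly; the latter needs `n₀ ≠ 0`.
  · refine Submodule.mem_sup.2 ⟨_, Submodule.mem_span_singleton.2
      ⟨l / w - (w * c₀ - l * p) / n₀ * (k / w), rfl⟩, _, Submodule.mem_span_singleton.2
      ⟨(w * c₀ - l * p) / n₀, rfl⟩, ?_⟩
    have f₀' := f₀ ▸ hn'
    ext i
    fin_cases i <;> simp [intVec, e₁, e₂] <;> field_simp <;> rw [f₀] <;> ring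
  · intro i
    fin_cases i <;> simp [abs_div]
  · refine Submodule.mem_span_singleton.2 ⟨k / w, ?_⟩
    ext i
    fin_cases i <;> simp [intVec, f₀, f₁, f₂] <;> field_simp <;> ring
  · intro i
    fin_cases i <;> simp [abs_div, abs_of_pos hw']

/-! ### Adding a fourth runner -/

/-- The fourth runner reaches its arc after waiting at most `(1 - ρ) / w`. The shrunken arcs leave
the others room to move meanwhile. -/
theorem Covers.snoc_of_window {x y z w ρ : ℝ} (hx : 0 ≤ x) (hy : 0 ≤ y) (hz : 0 ≤ z) (hw : 0 < w)
    (hρ : 0 ≤ ρ) (hρ1 : ρ ≤ 1)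
    (h : Covers ![x, y, z] ![ρ - (1 - ρ) * x / w, ρ - (1 - ρ) * y / w, ρ - (1 - ρ) * z / w]) :
    Covers ![x, y, z, w] fun _ => ρ := fun s => by
  obtain ⟨t, n, ht⟩ := h ![s 0, s 1, s 2]
  obtain ⟨δ, k, hδ0, hδ1, hk0, hk1⟩ : ∃ (δ : ℝ) (k : ℤ), 0 ≤ δ ∧ δ ≤ 1 - ρ ∧
      0 ≤ s 3 + t * w + δ + k ∧ s 3 + t * w + δ + k ≤ ρ := by
    have hf := Int.floor_add_fract (s 3 + t * w)
    have hf0 := Int.fract_nonneg (s 3 + t * w)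
    have hf1 := Int.fract_lt_one (s 3 + t * w)
    by_cases hc : Int.fract (s 3 + t * w) ≤ ρ
    · exact ⟨0, -⌊s 3 + t * w⌋, le_rfl, by linarith, by push_cast; linarith,
        by push_cast; linarith⟩
    · exact ⟨1 - Int.fract (s 3 + t * w), -⌊s 3 + t * w⌋ - 1, by linarith, by linarith,
        by push_cast; linarith, by push_cast; linarith⟩
  have key : ∀ c : ℝ, 0 ≤ c → 0 ≤ δ / w * c ∧ δ / w * c ≤ (1 - ρ) * c / w := fun c hc =>
    ⟨by positivity, by
      rw [div_mul_eq_mul_div]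
      gcongr⟩
  refine ⟨t + δ / w, ![n 0, n 1, n 2, k], fun i => ?_⟩
  have h0 := ht 0
  have h1 := ht 1
  have h2 := ht 2
  simp only [Matrix.cons_val] at h0 h1 h2
  have kx := key x hx
  have ky := key y hy
  have kz := key z hz
  have kw : δ / w * w = δ := div_mul_cancel₀ _ hw.ne'
  fin_cases i <;>
    simp only [Fin.zero_eta, Fin.mk_one, Fin.reduceFinMk, Matrix.cons_val, add_mul] <;>
    constructor <;> linarith

/-- Time shifts by multiples of `1 / g` fix the first three runners modulo 1, while the fourth runs
through steps of `1 / g ≤ ρ`. -/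
theorem Covers.snoc_of_coprime {x y z w g : ℤ} {ρ : ℝ} (hg : 2 ≤ g) (hgw : IsCoprime g w)
    (hρ : 1 / 2 ≤ ρ) (h : Covers ![(x : ℝ), y, z] fun _ => ρ) :
    Covers ![((g * x : ℤ) : ℝ), (g * y : ℤ), (g * z : ℤ), w] fun _ => ρ := fun s => by
  obtain ⟨t, n, ht⟩ := h ![s 0, s 1, s 2]
  have hg' : (2 : ℝ) ≤ g := by exact_mod_cast hg
  have hg0 : (0 : ℝ) < g := by linarith
  obtain ⟨c, k, hk0, hk1⟩ : ∃ (c : ℤ) (k : ℤ), 0 ≤ s 3 + t / g * w + c / g + k ∧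
      s 3 + t / g * w + c / g + k ≤ ρ := by
    have hf := Int.floor_add_fract (s 3 + t / g * w)
    have hf0 := Int.fract_nonneg (s 3 + t / g * w)
    have hf1 := Int.fract_lt_one (s 3 + t / g * w)
    by_cases hc : Int.fract (s 3 + t / g * w) ≤ ρ
    · exact ⟨0, -⌊s 3 + t / g * w⌋, by push_cast; rw [zero_div]; linarith,
        by push_cast; rw [zero_div]; linarith⟩
    · have h1 := Int.le_ceil ((1 - Int.fract (s 3 + t / g * w)) * g)
      have h2 := (Int.ceil_lt_add_one ((1 - Int.fract (s 3 + t / g * w)) * g)).le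
      rw [← le_div_iff₀ hg0] at h1
      rw [← div_le_div_iff_of_pos_right hg0, add_div, mul_div_cancel_right₀ _ hg0.ne'] at h2
      have h3 : 1 / (g : ℝ) ≤ 1 / 2 := one_div_le_one_div_of_le two_pos hg'
      exact ⟨⌈(1 - Int.fract (s 3 + t / g * w)) * g⌉, -⌊s 3 + t / g * w⌋ - 1,
        by push_cast; linarith, by push_cast; linarith⟩
  -- With `a * g + b * w = 1`, the extra time `c * b / g` moves a speed `g * q` by an integer and
  -- the speed `w` by `c / g` modulo 1.
  obtain ⟨a, b, hab⟩ := hgw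
  have hab' : (a : ℝ) * g + b * w = 1 := by exact_mod_cast hab
  have hbw : c * b / (g : ℝ) * w = c / g - c * a := by
    field_simp
    linear_combination (c : ℝ) * hab'
  refine ⟨t / g + c * b / g,
    ![n 0 - c * b * x, n 1 - c * b * y, n 2 - c * b * z, k + c * a], fun i => ?_⟩
  have hcan : ∀ q : ℝ, (t / g + c * b / g) * (g * q) = t * q + c * b * q := fun q => by
    field_simp
  have h0 := ht 0
  have h1 := ht 1
  have h2 := ht 2
  simp only [Matrix.cons_val] at h0 h1 h2
  fin_cases i <;> simp only [Fin.zero_eta, Fin.mk_one, Fin.reduceFinMk, Matrix.cons_val] <;>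
    push_cast <;> (try rw [hcan]) <;> (try rw [add_mul _ _ (w : ℝ), hbw]) <;>
    constructor <;> linarith

/-! ### Computable tests -/

/-! The tests below are written with `Nat.add`, `Nat.mul`, … instead of the overloaded operations,
because they are evaluated by the kernel. -/

def natDist (a b : ℕ) : ℕ := Nat.add (Nat.sub a b) (Nat.sub b a)

/-- `f k` for some `k` with `1 ≤ k ≤ n`, tested in increasing order. -/
def existsUpTo (f : ℕ → Bool) (n : ℕ) : Bool :=
  Nat.rec false (fun i ih => f (Nat.sub n i) || ih) n

def forallBelow (f : ℕ → Bool) (n : ℕ) : Bool :=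
  Nat.rec true (fun i ih => f i && ih) n

/-- The integer nearest to `k * x / w`. -/
def nearest (k x w : ℕ) : ℕ := Nat.div (Nat.add (Nat.mul 2 (Nat.mul k x)) w) (Nat.mul 2 w)

/-- The criterion `covers_of_planar` for `rᵢ = Rᵢ / U`. -/
def planarAux (x y z k a b R₁ R₂ R₃ U : ℕ) : Bool :=
  (fun m₁ m₂ m₃ =>
  Nat.ble (Nat.mul U m₂) (Nat.mul z R₁) && (Nat.ble (Nat.mul U m₁) (Nat.mul z R₂) &&
  (Nat.beq (Nat.gcd (Nat.gcd m₁ m₂) m₃) 1 &&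
  Nat.ble (Nat.add (Nat.mul U z) (Nat.mul 2 (Nat.mul U (Nat.mul m₁ m₂))))
    (Nat.mul z (Nat.add (Nat.add (Nat.mul m₁ R₁) (Nat.mul m₂ R₂)) (Nat.mul m₃ R₃))))))
  (natDist (Nat.mul k y) (Nat.mul z b)) (natDist (Nat.mul z a) (Nat.mul k x))
  (natDist (Nat.mul x b) (Nat.mul y a))

/-- Replacing `k` by `z - k` subtracts the integer vector from the speeds and only changes signs of
the minors, so half the range suffices. -/
def planar (x y z R₁ R₂ R₃ U : ℕ) : Bool :=
  existsUpTo (fun k => planarAux x y z k (nearest k x z) (nearest k y z) R₁ R₂ R₃ U) (Nat.div z 2)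

/-- The arcs of `Covers.snoc_of_window` for `ρ = 599 / 1000`, over the denominator `1000 * w`. -/
def planarAt (x y z w : ℕ) : Bool :=
  (fun W => planar x y z (Nat.sub W (Nat.mul 401 x)) (Nat.sub W (Nat.mul 401 y))
    (Nat.sub W (Nat.mul 401 z)) (Nat.mul 1000 w)) (Nat.mul 599 w)

/-- The absolute value of a determinant of order three. -/
def minor (x₁ x₂ x₃ y₁ y₂ y₃ z₁ z₂ z₃ : ℕ) : ℕ :=
  natDist
    (Nat.add (Nat.add (Nat.mul (Nat.mul x₁ y₂) z₃) (Nat.mul (Nat.mul x₂ y₃) z₁))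
      (Nat.mul (Nat.mul x₃ y₁) z₂))
    (Nat.add (Nat.add (Nat.mul (Nat.mul x₁ y₃) z₂) (Nat.mul (Nat.mul x₂ y₁) z₃))
      (Nat.mul (Nat.mul x₃ y₂) z₁))

/-- The criterion `covers_of_spatial` for `ρ = 599 / 1000`. -/
def spatialTest (w n₀ n₁ n₂ m₀ m₁ m₂ m₃ : ℕ) : Bool :=
  Nat.ble 1 n₀ && (Nat.ble (Nat.mul 1000 n₀) (Nat.mul 599 w) &&
  (Nat.ble (Nat.mul 1000 (Nat.add (Nat.mul n₁ n₀) (Nat.mul m₂ w))) (Nat.mul (Nat.mul 599 w) n₀) &&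
  (Nat.ble (Nat.mul 1000 (Nat.add (Nat.mul n₂ n₀) (Nat.mul m₁ w))) (Nat.mul (Nat.mul 599 w) n₀) &&
  (Nat.beq (Nat.gcd (Nat.gcd m₀ m₁) (Nat.gcd m₂ m₃)) 1 &&
  Nat.ble (Nat.add (Nat.add (Nat.mul (Nat.mul 1000 w) n₀) (Nat.mul (Nat.mul 1000 n₀)
      (Nat.add (Nat.add (Nat.mul m₀ n₀) (Nat.mul m₁ n₁)) (Nat.mul m₂ n₂))))
      (Nat.mul (Nat.mul 2000 w) (Nat.mul m₁ m₂)))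
    (Nat.mul (Nat.mul (Nat.mul 599 w) n₀) (Nat.add (Nat.add (Nat.add m₀ m₁) m₂) m₃))))))

def spatialAux (x y z w a₀ a₁ a₂ k c₀ c₁ c₂ l : ℕ) : Bool :=
  spatialTest w (natDist (Nat.mul w a₀) (Nat.mul k x)) (natDist (Nat.mul w a₁) (Nat.mul k y))
    (natDist (Nat.mul w a₂) (Nat.mul k z))
    (minor y z w a₁ a₂ k c₁ c₂ l) (minor x z w a₀ a₂ k c₀ c₂ l)
    (minor x y w a₀ a₁ k c₀ c₁ l) (minor x y z a₀ a₁ a₂ c₀ c₁ c₂)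

/-- Applies the criterion after a rotation of the first three speeds that makes `n₀` maximal. -/
def spatialPair (x y z w a₀ a₁ a₂ k c₀ c₁ c₂ l : ℕ) : Bool :=
  (fun n₀ n₁ n₂ =>
    bif Nat.ble n₂ (bif Nat.ble n₁ n₀ then n₀ else n₁) then
      bif Nat.ble n₁ n₀ then spatialAux x y z w a₀ a₁ a₂ k c₀ c₁ c₂ l
      else spatialAux y z x w a₁ a₂ a₀ k c₁ c₂ c₀ l
    else spatialAux z x y w a₂ a₀ a₁ k c₂ c₀ c₁ l)
  (natDist (Nat.mul w a₀) (Nat.mul k x)) (natDist (Nat.mul w a₁) (Nat.mul k y))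
  (natDist (Nat.mul w a₂) (Nat.mul k z))

/-- The cap 12 on `l` only limits the search; any pair passing the test is a certificate. -/
def spatial (x y z w : ℕ) : Bool :=
  existsUpTo (fun k => existsUpTo (fun l =>
    spatialPair x y z w (nearest k x w) (nearest k y w) (nearest k z w) k
      (nearest l x w) (nearest l y w) (nearest l z w) l) 12) (Nat.div w 2)

/-- Speeds, each with a grid size, that need `covers_of_grid` instead of the criteria above. -/
def sporadic : List (ℕ × ℕ × ℕ × ℕ × ℕ) := [
  (1, 2, 3, 5, 120), (1, 2, 3, 6, 42), (1, 2, 3, 7, 42), (1, 2, 3, 8, 48), (1, 2, 3, 9, 36),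
  (1, 2, 3, 10, 60), (1, 2, 3, 11, 66), (1, 2, 3, 12, 24), (1, 2, 3, 13, 78), (1, 2, 3, 14, 42),
  (1, 2, 3, 15, 60), (1, 2, 3, 16, 48), (1, 2, 3, 17, 102), (1, 2, 3, 18, 36), (1, 2, 5, 6, 60),
  (1, 3, 4, 5, 180), (1, 3, 4, 8, 72), (1, 3, 4, 9, 36), (1, 3, 4, 10, 60), (1, 4, 5, 6, 120),
  (1, 4, 5, 7, 140), (1, 4, 5, 8, 80), (1, 4, 5, 9, 180), (1, 4, 5, 10, 40), (1, 5, 6, 7, 210),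
  (1, 5, 6, 8, 120), (1, 5, 6, 10, 90), (1, 6, 7, 9, 126), (1, 6, 7, 10, 210), (1, 7, 8, 9, 504),
  (1, 8, 9, 10, 360), (2, 3, 4, 5, 60), (2, 3, 4, 7, 84), (2, 3, 5, 6, 120), (2, 3, 5, 7, 420),
  (2, 3, 5, 9, 90), (2, 3, 5, 10, 60), (2, 5, 6, 7, 210), (2, 5, 7, 8, 280), (2, 5, 7, 9, 630),
  (2, 5, 7, 10, 70), (3, 4, 5, 6, 60), (3, 4, 5, 7, 420), (3, 4, 7, 8, 168), (3, 4, 7, 9, 252),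
  (3, 4, 7, 10, 420), (4, 5, 6, 7, 420), (4, 5, 9, 10, 180)]

def isTight (x y z w : ℕ) : Bool :=
  Nat.beq x 1 && ((Nat.beq y 2 && (Nat.beq z 3 && Nat.beq w 4)) ||
    (Nat.beq y 3 && (Nat.beq z 4 && (Nat.beq w 6 || Nat.beq w 7))))

def isSporadic (x y z w : ℕ) : Bool :=
  isTight x y z w || sporadic.any fun e =>
    Nat.beq e.1 x && (Nat.beq e.2.1 y && (Nat.beq e.2.2.1 z && Nat.beq e.2.2.2.1 w))

/-- Tests all fourth speeds from `w` to `w + n - 1`, stopping when the planar criterion holds. -/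
def checkFourth (x y z n w : ℕ) : Bool :=
  Nat.rec (motive := fun _ => ℕ → Bool) (fun _ => true)
    (fun _ ih w => planarAt x y z w ||
      ((isSporadic x y z w || (spatial x y z w || spatial x y w z)) && ih (Nat.succ w))) n w

/-- The number of steps makes `195 - x - y - z` the last fourth speed tested. -/
def checkTriple (x y z : ℕ) : Bool :=
  (fun g => bif Nat.beq g 1 then
      checkFourth x y z (Nat.sub 195 (Nat.add (Nat.add x y) (Nat.mul 2 z))) (Nat.succ z)
    else planar (Nat.div x g) (Nat.div y g) (Nat.div z g) 599 599 599 1000)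
    (Nat.gcd (Nat.gcd x y) z)

def checkFirst (x : ℕ) : Bool :=
  forallBelow (fun y => Nat.ble y x || forallBelow (fun z => Nat.ble z y || checkTriple x y z)
    (Nat.succ (Nat.div (Nat.sub 194 (Nat.add x y)) 2))) 65

/-! ### Soundness of the tests -/

theorem exists_of_existsUpTo {f : ℕ → Bool} {n : ℕ} (h : existsUpTo f n = true) :
    ∃ k, f k = true := by
  have : ∀ i, Nat.rec (motive := fun _ => Bool) false (fun i ih => f (n - i) || ih) i = true →
      ∃ k, f k = true := by
    intro i
    induction i with
    | zero => intro h; cases h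
    | succ i ih =>
      intro h
      rcases Bool.or_eq_true_iff.1 h with h | h
      · exact ⟨_, h⟩
      · exact ih h
  exact this n h

theorem forallBelow_apply {f : ℕ → Bool} {n : ℕ} (h : forallBelow f n = true) :
    ∀ i < n, f i = true := by
  induction n with
  | zero => intro i hi; omega
  | succ n ih =>
    have h' := Bool.and_eq_true_iff.1 h
    intro i hi
    rcases Nat.lt_succ_iff_lt_or_eq.1 hi with hi | rfl
    · exact ih h'.2 i hi
    · exact h'.1

theorem natDist_eq_natAbs (a b : ℕ) : natDist a b = ((a : ℤ) - b).natAbs := by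
  simp only [natDist, Nat.add_eq, Nat.sub_eq]
  omega

theorem natDist_cast (a b : ℕ) : ((natDist a b : ℕ) : ℝ) = |((((a : ℤ) - b : ℤ)) : ℝ)| := by
  rw [natDist_eq_natAbs, ← Int.cast_abs, Int.abs_eq_natAbs, Int.cast_natCast]

theorem covers_of_planarAux {x y z k a b R₁ R₂ R₃ U : ℕ} (hz : 0 < z) (hU : 0 < U)
    (h : planarAux x y z k a b R₁ R₂ R₃ U = true) :
    Covers ![(x : ℝ), y, z] ![(R₁ : ℝ) / U, R₂ / U, R₃ / U] := by
  simp only [planarAux, Bool.and_eq_true, Nat.ble_eq, Nat.beq_eq, Nat.mul_eq, Nat.add_eq] at h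
  obtain ⟨h₁, h₂, hg, hW⟩ := h
  have hz' : (0 : ℝ) < z := by exact_mod_cast hz
  have hU' : (0 : ℝ) < U := by exact_mod_cast hU
  have key := covers_of_planar (x := x) (y := y) (z := z) (a := a) (b := b) (k := k)
    (r₁ := (R₁ : ℝ) / U) (r₂ := (R₂ : ℝ) / U) (r₃ := (R₃ : ℝ) / U)
    (by exact_mod_cast hz) _ _ _ rfl rfl rfl
  simp only [← Nat.cast_mul, ← natDist_eq_natAbs, ← natDist_cast, Int.cast_natCast] at key
  generalize natDist (k * y) (z * b) = m₁ at *
  generalize natDist (z * a) (k * x) = m₂ at *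
  generalize natDist (x * b) (y * a) = m₃ at *
  have h₁' : (U : ℝ) * m₂ ≤ z * R₁ := by exact_mod_cast h₁
  have h₂' : (U : ℝ) * m₁ ≤ z * R₂ := by exact_mod_cast h₂
  have hW' : (U : ℝ) * z + 2 * (U * (m₁ * m₂)) ≤ z * (m₁ * R₁ + m₂ * R₂ + m₃ * R₃) := by
    exact_mod_cast hW
  refine key hg ?_ ?_ (by positivity) ?_
  · rw [div_le_div_iff₀ hz' hU']; linarith
  · rw [div_le_div_iff₀ hz' hU']; linarith
  · have : (m₁ : ℝ) * (R₁ / U - m₂ / z) + m₂ * (R₂ / U - m₁ / z) + m₃ * (R₃ / U) =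
        (z * (m₁ * R₁ + m₂ * R₂ + m₃ * R₃) - 2 * (U * (m₁ * m₂))) / (U * z) := by
      field_simp; ring
    rw [this, one_le_div (by positivity)]
    linarith

theorem covers_of_planar_eq_true {x y z R₁ R₂ R₃ U : ℕ} (hz : 0 < z) (hU : 0 < U)
    (h : planar x y z R₁ R₂ R₃ U = true) :
    Covers ![(x : ℝ), y, z] ![(R₁ : ℝ) / U, R₂ / U, R₃ / U] :=
  let ⟨_, hk⟩ := exists_of_existsUpTo h
  covers_of_planarAux hz hU hk

theorem covers_of_planarAt {x y z w w' : ℕ} (hxy : x ≤ y) (hyz : y ≤ z) (hz : 0 < z) (hzw : z ≤ w)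
    (hw : w ≤ w') (h : planarAt x y z w = true) :
    Covers ![(x : ℝ), y, z, w'] fun _ => 599 / 1000 := by
  simp only [planarAt, Nat.mul_eq, Nat.sub_eq] at h
  have hw0 : (0 : ℝ) < w := by exact_mod_cast hz.trans_le hzw
  have hww : (w : ℝ) ≤ w' := by exact_mod_cast hw
  refine Covers.snoc_of_window (by positivity) (by positivity) (by positivity)
    (hw0.trans_le hww) (by norm_num) (by norm_num)
    ((covers_of_planar_eq_true hz (by omega) h).mono ?_)
  have key : ∀ c : ℕ, c ≤ w → ((599 * w - 401 * c : ℕ) : ℝ) / (1000 * w : ℕ) ≤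
      599 / 1000 - (1 - 599 / 1000) * c / w' := by
    intro c hc
    rw [Nat.cast_sub (by omega)]
    push_cast
    have h1 : (c : ℝ) / w' ≤ c / w := by gcongr
    have h2 : (599 * (w : ℝ) - 401 * c) / (1000 * w) = 599 / 1000 - 401 / 1000 * (c / w) := by
      field_simp
    rw [h2, mul_div_assoc]
    linarith
  intro i
  fin_cases i
  exacts [key x (by omega), key y (by omega), key z (by omega)]

theorem covers_of_spatialAux {x y z w a₀ a₁ a₂ k c₀ c₁ c₂ l : ℕ} (hw : 0 < w)
    (h : spatialAux x y z w a₀ a₁ a₂ k c₀ c₁ c₂ l = true) :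
    Covers ![(x : ℝ), y, z, w] fun _ => 599 / 1000 := by
  have key := covers_of_spatial (p := x) (q := y) (r := z) (w := w) (a₀ := a₀) (a₁ := a₁)
    (a₂ := a₂) (k := k) (c₀ := c₀) (c₁ := c₁) (c₂ := c₂) (l := l) (ρ := 599 / 1000)
    (by exact_mod_cast hw) _ _ _ _ _ _ _ rfl rfl rfl rfl rfl rfl rfl
  rw [← Int.natAbs_ne_zero] at key
  simp only [Int.natAbs_neg, Int.cast_neg, abs_neg, ← Nat.cast_mul, ← Nat.cast_add,
    ← natDist_eq_natAbs, ← natDist_cast, Int.cast_natCast] at key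
  simp only [spatialAux, minor, Nat.mul_eq, Nat.add_eq] at h
  generalize natDist (w * a₀) (k * x) = n₀ at *
  generalize natDist (w * a₁) (k * y) = n₁ at *
  generalize natDist (w * a₂) (k * z) = n₂ at *
  generalize natDist (y * a₂ * l + z * k * c₁ + w * a₁ * c₂)
    (y * k * c₂ + z * a₁ * l + w * a₂ * c₁) = m₀ at *
  generalize natDist (x * a₂ * l + z * k * c₀ + w * a₀ * c₂)
    (x * k * c₂ + z * a₀ * l + w * a₂ * c₀) = m₁ at *
  generalize natDist (x * a₁ * l + y * k * c₀ + w * a₀ * c₁)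
    (x * k * c₁ + y * a₀ * l + w * a₁ * c₀) = m₂ at *
  generalize natDist (x * a₁ * c₂ + y * a₂ * c₀ + z * a₀ * c₁)
    (x * a₂ * c₁ + y * a₀ * c₂ + z * a₁ * c₀) = m₃ at *
  simp only [spatialTest, Bool.and_eq_true, Nat.ble_eq, Nat.beq_eq, Nat.mul_eq, Nat.add_eq] at h
  obtain ⟨hn, h₀, h₁, h₂, hg, hW⟩ := h
  have hn' : (0 : ℝ) < n₀ := by exact_mod_cast hn
  have hw' : (0 : ℝ) < w := by exact_mod_cast hw
  have h₀' : 1000 * (n₀ : ℝ) ≤ 599 * w := by exact_mod_cast h₀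
  have h₁' : 1000 * ((n₁ : ℝ) * n₀ + m₂ * w) ≤ 599 * w * n₀ := by exact_mod_cast h₁
  have h₂' : 1000 * ((n₂ : ℝ) * n₀ + m₁ * w) ≤ 599 * w * n₀ := by exact_mod_cast h₂
  have hW' : 1000 * (w : ℝ) * n₀ + 1000 * n₀ * (m₀ * n₀ + m₁ * n₁ + m₂ * n₂) +
      2000 * w * (m₁ * m₂) ≤ 599 * w * n₀ * (m₀ + m₁ + m₂ + m₃) := by exact_mod_cast hW
  refine key hg (by omega) ?_ ?_ ?_ ?_
  · rw [div_le_div_iff₀ hw' (by norm_num)]; linarith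
  · rw [div_add_div _ _ hw'.ne' hn'.ne', div_le_div_iff₀ (by positivity) (by norm_num)]; linarith
  · rw [div_add_div _ _ hw'.ne' hn'.ne', div_le_div_iff₀ (by positivity) (by norm_num)]; linarith
  · have : (m₀ : ℝ) * (599 / 1000 - n₀ / w) + m₁ * (599 / 1000 - n₁ / w - m₂ / n₀) +
        m₂ * (599 / 1000 - n₂ / w - m₁ / n₀) + m₃ * (599 / 1000) =
        (599 * w * n₀ * (m₀ + m₁ + m₂ + m₃) -
          (1000 * n₀ * (m₀ * n₀ + m₁ * n₁ + m₂ * n₂) + 2000 * w * (m₁ * m₂))) /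
          (1000 * w * n₀) := by
      field_simp; ring
    rw [this, one_le_div (by positivity)]
    linarith

theorem Covers.of_comp_perm {n : ℕ} {v v' : Fin n → ℝ} {ρ : ℝ} (σ : Equiv.Perm (Fin n))
    (h : Covers v' fun _ => ρ) (hv : v' = v ∘ σ) : Covers v fun _ => ρ := by
  subst hv
  exact Covers.perm (r := fun _ => ρ) σ h

theorem covers_of_spatial_eq_true {x y z w : ℕ} (hw : 0 < w) (h : spatial x y z w = true) :
    Covers ![(x : ℝ), y, z, w] fun _ => 599 / 1000 := by
  obtain ⟨k, hk⟩ := exists_of_existsUpTo h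
  obtain ⟨l, hl⟩ := exists_of_existsUpTo hk
  have aux₁ : spatialAux y z x w (nearest k y w) (nearest k z w) (nearest k x w) k (nearest l y w)
      (nearest l z w) (nearest l x w) l = true →
      Covers ![(x : ℝ), y, z, w] fun _ => 599 / 1000 := fun hl => by
    refine (covers_of_spatialAux hw hl).of_comp_perm (Equiv.swap 0 1 * Equiv.swap 1 2) ?_
    ext i
    fin_cases i <;> rfl
  have aux₂ : spatialAux z x y w (nearest k z w) (nearest k x w) (nearest k y w) k (nearest l z w)
      (nearest l x w) (nearest l y w) l = true →
      Covers ![(x : ℝ), y, z, w] fun _ => 599 / 1000 := fun hl => by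
    refine (covers_of_spatialAux hw hl).of_comp_perm (Equiv.swap 1 2 * Equiv.swap 0 1) ?_
    ext i
    fin_cases i <;> rfl
  simp only [spatialPair, Bool.cond_eq_ite] at hl
  split_ifs at hl
  exacts [covers_of_spatialAux hw hl, aux₂ hl, aux₁ hl, aux₂ hl]

theorem covers_of_checkFourth {x y z n w w' : ℕ} (hxy : x ≤ y) (hyz : y ≤ z) (hz : 0 < z)
    (hzw : z ≤ w) (hw : w ≤ w') (hn : w' < w + n) (h : checkFourth x y z n w = true) :
    (Covers ![(x : ℝ), y, z, w'] fun _ => 599 / 1000) ∨ isSporadic x y z w' = true := by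
  induction n generalizing w with
  | zero => omega
  | succ n ih =>
    have h' : (planarAt x y z w || ((isSporadic x y z w || (spatial x y z w || spatial x y w z)) &&
      checkFourth x y z n (w + 1))) = true := h
    simp only [Bool.or_eq_true, Bool.and_eq_true] at h'
    rcases h' with h' | ⟨h1, h2⟩
    · exact .inl (covers_of_planarAt hxy hyz hz hzw hw h')
    · rcases hw.eq_or_lt with rfl | hw
      · rcases h1 with h1 | h1 | h1
        · exact .inr h1
        · exact .inl (covers_of_spatial_eq_true (by omega) h1)
        · refine .inl ((covers_of_spatial_eq_true hz h1).of_comp_perm (Equiv.swap 2 3) ?_)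
          ext i
          fin_cases i <;> rfl
      · exact ih (by omega) (by omega) (by omega) h2

theorem covers_of_checkTriple {x y z w : ℕ} (hx : 0 < x) (hxy : x < y) (hyz : y < z) (hzw : z < w)
    (hsum : x + y + z + w ≤ 195) (hg : Nat.gcd (Nat.gcd (Nat.gcd x y) z) w = 1)
    (h : checkTriple x y z = true) :
    (Covers ![(x : ℝ), y, z, w] fun _ => 599 / 1000) ∨ isSporadic x y z w = true := by
  simp only [checkTriple, Nat.add_eq, Nat.mul_eq, Nat.sub_eq] at h
  cases hg1 : Nat.beq (Nat.gcd (Nat.gcd x y) z) 1 <;> rw [hg1] at h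
  rotate_left
  · exact covers_of_checkFourth hxy.le hyz.le (by omega) (Nat.le_succ z) hzw (by omega) h
  · left
    set g := Nat.gcd (Nat.gcd x y) z with hgdef
    have hg0 : 0 < g := Nat.gcd_pos_of_pos_right _ (by omega)
    have hg1' : g ≠ 1 := Nat.ne_of_beq_eq_false hg1
    have hgx : g ∣ x := (Nat.gcd_dvd_left _ _).trans (Nat.gcd_dvd_left _ _)
    have hgy : g ∣ y := (Nat.gcd_dvd_left _ _).trans (Nat.gcd_dvd_right _ _)
    have hgz : g ∣ z := Nat.gcd_dvd_right _ _
    have key := covers_of_planar_eq_true (Nat.div_pos (Nat.le_of_dvd (by omega) hgz) hg0)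
      (by norm_num) h
    have key2 := Covers.snoc_of_coprime (x := (x / g : ℕ)) (y := (y / g : ℕ)) (z := (z / g : ℕ))
      (w := w) (g := g) (ρ := 599 / 1000) (by omega) (Nat.isCoprime_iff_coprime.2 hg)
      (by norm_num) (key.mono fun i => by fin_cases i <;> norm_num)
    simpa only [← Nat.cast_mul, Nat.mul_div_cancel' hgx, Nat.mul_div_cancel' hgy,
      Nat.mul_div_cancel' hgz, Int.cast_natCast] using key2

theorem covers_of_checkFirst {x y z w : ℕ} (hx : 0 < x) (hxy : x < y) (hyz : y < z) (hzw : z < w)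
    (hsum : x + y + z + w ≤ 195) (hg : Nat.gcd (Nat.gcd (Nat.gcd x y) z) w = 1)
    (h : checkFirst x = true) :
    (Covers ![(x : ℝ), y, z, w] fun _ => 599 / 1000) ∨ isSporadic x y z w = true := by
  have h1 := (Bool.or_eq_true_iff.1 (forallBelow_apply h y (by omega))).resolve_left
    fun hle => absurd (Nat.le_of_ble_eq_true hle) (by omega)
  have hz : z < Nat.succ ((194 - (x + y)) / 2) := by omega
  have h2 := (Bool.or_eq_true_iff.1 (forallBelow_apply h1 z hz)).resolve_left
    fun hle => absurd (Nat.le_of_ble_eq_true hle) (by omega)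
  exact covers_of_checkTriple hx hxy hyz hzw hsum hg h2

/-! ### Discretizing time and starting points -/

section Grid

variable {n : ℕ}

/-- At time `τ / N` runner `i` has moved `τ / M i`. Rounding its start down to a multiple of `1 / M
i` costs less than one grid step, whence `L i + 1`. -/
theorem covers_of_grid {v M L : Fin n → ℕ} {N : ℕ} {ρ : ℝ} (hN : 0 < N) (hM : ∀ i, v i * M i = N)
    (hL : ∀ i, ((L i : ℝ) + 1) * v i ≤ ρ * N)
    (h : ∀ a : Fin n → ℤ, ∃ τ : ℤ, ∀ i, (τ + a i) % M i ≤ L i) :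
    Covers (fun i => (v i : ℝ)) fun _ => ρ := fun s => by
  obtain ⟨τ, hτ⟩ := h fun i => ⌊s i * M i⌋
  refine ⟨τ / N, fun i => -((τ + ⌊s i * M i⌋) / M i), fun i => ?_⟩
  have hMi : 0 < M i := Nat.pos_of_mul_pos_left (by rw [hM]; exact hN)
  have hvi : 0 < v i := Nat.pos_of_mul_pos_right (by rw [hM]; exact hN)
  have hMr : (0 : ℝ) < M i := by exact_mod_cast hMi
  have hvr : (0 : ℝ) < v i := by exact_mod_cast hvi
  have hNr : (v i : ℝ) * M i = N := by exact_mod_cast hM i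
  have h0 : (0 : ℝ) ≤ ((τ + ⌊s i * M i⌋) % M i : ℤ) := by
    exact_mod_cast Int.emod_nonneg _ (by omega)
  have h1 : (((τ + ⌊s i * M i⌋) % M i : ℤ) : ℝ) ≤ L i := by exact_mod_cast hτ i
  have h2 : (M i : ℝ) * ((τ + ⌊s i * M i⌋) / M i : ℤ) + ((τ + ⌊s i * M i⌋) % M i : ℤ) =
      τ + ⌊s i * M i⌋ := by exact_mod_cast Int.mul_ediv_add_emod (τ + ⌊s i * M i⌋) (M i)
  have hf := Int.floor_add_fract (s i * M i)
  have hf0 := Int.fract_nonneg (s i * M i)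
  have hf1 := Int.fract_lt_one (s i * M i)
  have key : s i + τ / N * v i + ((-((τ + ⌊s i * M i⌋) / M i) : ℤ) : ℝ) =
      (((τ + ⌊s i * M i⌋) % M i : ℤ) + Int.fract (s i * M i)) / M i := by
    rw [← hNr, eq_div_iff hMr.ne']
    push_cast at h2 ⊢
    field_simp
    linarith
  rw [key]
  refine ⟨by positivity, ?_⟩
  rw [div_le_iff₀ hMr]
  have := hL i
  rw [← hNr] at this
  nlinarith

/-- A lossless version of `covers_of_grid`: the order of the fractional parts of the starting
points is recorded on a grid that is finer by the factor `4`. -/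
theorem covers_of_refined_grid {v M P : Fin 4 → ℕ} {N : ℕ} {ρ : ℝ} (hN : 0 < N)
    (hM : ∀ i, v i * M i = N) (hP : ∀ i, (P i : ℝ) ≤ ρ * M i)
    (h : ∀ a : Fin 4 → ℤ, ∃ τ : ℤ, ∀ i, (τ + a i) % (4 * M i : ℕ) ≤ (4 * P i : ℕ)) :
    Covers (fun i => (v i : ℝ)) fun _ => ρ := fun s => by
  set f : Fin 4 → ℝ := fun i => Int.fract (s i * M i) with hf
  -- Ranks of the fractional parts, with ties sharing a rank. They are at most 3, so they fit below
  -- the refinement factor 4.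
  set r : Fin 4 → ℕ := fun i => (Finset.univ.filter fun k => f k < f i).card with hr
  have hr3 : ∀ i, r i ≤ 3 := fun i => by
    have : r i < Fintype.card (Fin 4) := Finset.card_lt_univ_of_notMem (x := i) (by simp)
    simpa using Nat.le_of_lt_succ this
  have hrf : ∀ i j, r i ≤ r j → f i ≤ f j := fun i j hij => by
    by_contra! hc
    refine absurd hij (not_le.2 (Finset.card_lt_card ⟨fun k hk => ?_, fun hs => ?_⟩))
    · simp only [Finset.mem_filter, Finset.mem_univ, true_and] at hk ⊢
      exact hk.trans hc
    · have := hs (x := j) (by simpa using hc)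
      simp at this
  obtain ⟨τ, hτ⟩ := h fun i => 4 * ⌊s i * M i⌋ + r i
  set k : Fin 4 → ℤ := fun i => (τ + (4 * ⌊s i * M i⌋ + r i)) / (4 * M i : ℕ) with hk
  -- `c i / N` is the time at which runner `i` enters its arc on the lap selected by `k i`.
  set c : Fin 4 → ℝ := fun i => M i * k i - s i * M i with hc
  have hMi : ∀ i, 0 < M i := fun i => Nat.pos_of_mul_pos_left (by rw [hM]; exact hN)
  have hcP : ∀ i j, c i ≤ c j + P j := fun i j => by
    have hi0 := Int.emod_nonneg (τ + (4 * ⌊s i * M i⌋ + r i)) (b := (4 * M i : ℕ))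
      (by have := hMi i; omega)
    have hi1 := Int.mul_ediv_add_emod (τ + (4 * ⌊s i * M i⌋ + r i)) (4 * M i : ℕ)
    have hj0 := hτ j
    have hj1 := Int.mul_ediv_add_emod (τ + (4 * ⌊s j * M j⌋ + r j)) (4 * M j : ℕ)
    change ((4 * M i : ℕ) : ℤ) * k i + _ = _ at hi1
    change ((4 * M j : ℕ) : ℤ) * k j + _ = _ at hj1
    have hri := hr3 i
    have hrj := hr3 j
    have hfi := Int.floor_add_fract (s i * M i)
    have hfj := Int.floor_add_fract (s j * M j)
    change _ + f i = _ at hfi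
    change _ + f j = _ at hfj
    have hfi0 : 0 ≤ f i := Int.fract_nonneg _
    have hfj1 : f j < 1 := Int.fract_lt_one _
    set X : ℤ := M i * k i - ⌊s i * M i⌋ - (M j * k j - ⌊s j * M j⌋ + P j) with hX
    have h4X : 4 * X ≤ r i - r j := by
      push_cast at hi0 hi1 hj0 hj1
      linarith
    have hXr : (X : ℝ) = M i * k i - ⌊s i * M i⌋ - (M j * k j - ⌊s j * M j⌋ + P j) := by
      rw [hX]; push_cast; ring
    -- Rank differences are below 4, so `X ≤ 0`; if `X = 0`, the ranks order the fractional parts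
    -- correctly.
    have hXf : (X : ℝ) ≤ f i - f j := by
      rcases (show X ≤ 0 by omega).lt_or_eq with hX0 | hX0
      · have : (X : ℝ) ≤ -1 := by exact_mod_cast (show X ≤ -1 by omega)
        linarith
      · have := hrf j i (by omega)
        rw [hX0, Int.cast_zero]
        linarith
    simp only [hc]
    linarith
  -- The time windows meet pairwise, hence have a common point: the latest entry time.
  obtain ⟨i₀, hi₀⟩ := Finite.exists_max c
  refine ⟨c i₀ / N, fun i => - k i, fun i => ?_⟩
  have hMr : (0 : ℝ) < M i := by exact_mod_cast hMi i
  have hvr : (0 : ℝ) < v i := by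
    exact_mod_cast Nat.pos_of_mul_pos_right (by rw [hM]; exact hN)
  have hNr : (v i : ℝ) * M i = N := by exact_mod_cast hM i
  have key : s i + c i₀ / N * v i + ((- k i : ℤ) : ℝ) = (c i₀ - c i) / M i := by
    rw [← hNr]
    push_cast
    simp only [hc]
    field_simp
    ring
  rw [key]
  refine ⟨div_nonneg (sub_nonneg.2 (hi₀ i)) hMr.le, ?_⟩
  rw [div_le_iff₀ hMr]
  linarith [hcP i₀ i, hP i]

/-- Between consecutive grid times all residues keep their integer parts, so a runner with residue
at least `P i` stays beyond `ρ` and short of the next lap. -/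
theorem not_covers_of_grid {v M P a : Fin n → ℕ} {N : ℕ} {ρ : ℝ} (hN : 0 < N)
    (hM : ∀ i, v i * M i = N) (hP : ∀ i, ρ * M i < P i)
    (h : ∀ τ < N, ∃ i, P i ≤ (τ + a i) % M i) :
    ¬ Covers (fun i => (v i : ℝ)) fun _ => ρ := fun hcov => by
  obtain ⟨t, z, ht⟩ := hcov fun i => a i / M i
  have hNz : (N : ℤ) ≠ 0 := by omega
  obtain ⟨i, hi⟩ := h (⌊t * N⌋ % N).toNat (by
    have := Int.emod_lt_of_pos ⌊t * N⌋ (b := N) (by omega)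
    have := Int.emod_nonneg ⌊t * N⌋ hNz
    omega)
  have hMi : 0 < M i := Nat.pos_of_mul_pos_left (by rw [hM]; exact hN)
  have hMr : (0 : ℝ) < M i := by exact_mod_cast hMi
  have hNr : (v i : ℝ) * M i = N := by exact_mod_cast hM i
  have hdvd : (M i : ℤ) ∣ N := ⟨v i, by rw [mul_comm]; exact_mod_cast (hM i).symm⟩
  have hi' : (P i : ℤ) ≤ (⌊t * N⌋ + a i) % M i := by
    have e : (((⌊t * N⌋ % N).toNat + a i : ℕ) : ℤ) % M i = (⌊t * N⌋ + a i) % M i := by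
      rw [Nat.cast_add, Int.toNat_of_nonneg (Int.emod_nonneg _ hNz), Int.add_emod,
        Int.emod_emod_of_dvd _ hdvd, ← Int.add_emod]
    rw [← e]
    exact_mod_cast hi
  have h1 := Int.emod_lt_of_pos (⌊t * N⌋ + a i) (b := M i) (by omega)
  have h2 := Int.mul_ediv_add_emod (⌊t * N⌋ + a i) (M i)
  set e := (⌊t * N⌋ + a i) % M i
  set q := (⌊t * N⌋ + a i) / M i
  have hf := Int.floor_add_fract (t * N)
  have hf0 := Int.fract_nonneg (t * N)
  have hf1 := Int.fract_lt_one (t * N)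
  have h2' : (M i : ℝ) * q + e = ⌊t * N⌋ + a i := by exact_mod_cast h2
  have hi'' : (P i : ℝ) ≤ e := by exact_mod_cast hi'
  have h1' : (e : ℝ) ≤ M i - 1 := by exact_mod_cast (show e ≤ M i - 1 by omega)
  have key : a i / M i + t * v i + z i = (e + Int.fract (t * N)) / M i + (q + z i : ℤ) := by
    have hNt : t * v i * M i = t * N := by rw [← hNr]; ring
    generalize Int.fract (t * N) = f at *
    push_cast
    field_simp
    linarith
  have := ht i
  simp only [key] at this
  rcases lt_or_ge (q + z i) 0 with hq | hq
  · have hq' : ((q + z i : ℤ) : ℝ) ≤ -1 := by exact_mod_cast (show q + z i ≤ -1 by omega)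
    have : (e + Int.fract (t * N)) / M i < 1 := (div_lt_one hMr).2 (by linarith)
    linarith
  · have hq' : (0 : ℝ) ≤ (q + z i : ℤ) := by exact_mod_cast hq
    have : ρ < (e + Int.fract (t * N)) / M i := (lt_div_iff₀ hMr).2 (by linarith [hP i])
    linarith

end Grid

/-! ### Bit masks for the grid condition -/

/-- Bit `j` of `progMask M L n` is set when `j < M * n` and `j % M ≤ L`. -/
def progMask (M L n : ℕ) : ℕ :=
  Nat.rec 0 (fun _ ih => Nat.lor (Nat.shiftLeft ih M) (Nat.sub (Nat.pow 2 (Nat.succ L)) 1)) n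

theorem mod_le_of_testBit_progMask {M L n j : ℕ} (h : (progMask M L n).testBit j = true) :
    j % M ≤ L := by
  induction n generalizing j with
  | zero => simp [progMask] at h
  | succ n ih =>
    have h' : (progMask M L n <<< M ||| (2 ^ (L + 1) - 1)).testBit j = true := h
    simp only [Nat.testBit_or, Nat.testBit_shiftLeft, Nat.testBit_two_pow_sub_one,
      Bool.or_eq_true, Bool.and_eq_true, decide_eq_true_eq] at h'
    rcases h' with ⟨h1, h2⟩ | h1
    · rw [Nat.mod_eq_sub_mod h1]
      exact ih h2
    · exact (Nat.mod_le _ _).trans (by omega)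

/-- The union of the right shifts of `F` by all subset sums of the list. -/
def spread : List ℕ → ℕ → ℕ
  | [], F => F
  | d :: l, F => spread l (Nat.lor F (Nat.shiftRight F d))

theorem exists_testBit_of_spread {l : List ℕ} {F j : ℕ} (h : (spread l F).testBit j = true) :
    ∃ δ ≤ l.sum, F.testBit (j + δ) = true := by
  induction l generalizing F with
  | nil => exact ⟨0, le_rfl, h⟩
  | cons d l ih =>
    obtain ⟨δ, hδ, h1⟩ := ih (F := F ||| F >>> d) h
    simp only [Nat.testBit_or, Nat.testBit_shiftRight, Bool.or_eq_true] at h1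
    rcases h1 with h1 | h1
    · exact ⟨δ, hδ.trans (by simp), h1⟩
    · exact ⟨d + δ, by simpa using hδ, by rwa [Nat.add_left_comm] at h1⟩

/-- Steps of total length `L` such that every number up to `L` is the sum of some of them. -/
def spreadSteps (L : ℕ) : List ℕ :=
  (List.range (Nat.log2 (L + 1))).map (2 ^ ·) ++ [L + 1 - 2 ^ Nat.log2 (L + 1)]

/-- The low `M` bits record which residues modulo `M` occur among the first `K` blocks. -/
def foldMask (M K F : ℕ) : ℕ :=
  Nat.rec 0 (fun i ih => Nat.lor ih (Nat.shiftRight F (Nat.mul i M))) K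

theorem exists_testBit_of_foldMask {M K F j : ℕ} (h : (foldMask M K F).testBit j = true) :
    ∃ i, F.testBit (i * M + j) = true := by
  induction K with
  | zero => simp [foldMask] at h
  | succ K ih =>
    have h' : (foldMask M K F ||| F >>> (K * M)).testBit j = true := h
    simp only [Nat.testBit_or, Nat.testBit_shiftRight, Bool.or_eq_true] at h'
    exact h'.elim ih fun h' => ⟨K, h'⟩

def shiftCheck (F : ℕ) (l : List ℕ) (M K : ℕ) : Bool :=
  (fun B => Nat.beq (Nat.land (foldMask M K (spread l F)) B) B) (Nat.sub (Nat.pow 2 M) 1)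

theorem exists_testBit_of_shiftCheck {F M K : ℕ} {l : List ℕ} (h : shiftCheck F l M K = true)
    {e : ℕ} (he : e < M) : ∃ i, ∃ δ ≤ l.sum, F.testBit (i * M + e + δ) = true := by
  have h0 : foldMask M K (spread l F) &&& (2 ^ M - 1) = 2 ^ M - 1 := Nat.eq_of_beq_eq_true h
  have h1 := congrArg (fun x => x.testBit e) h0
  simp only [Nat.testBit_and, Nat.testBit_two_pow_sub_one, he, decide_true, Bool.and_true] at h1
  obtain ⟨i, hi⟩ := exists_testBit_of_foldMask h1
  exact ⟨i, exists_testBit_of_spread hi⟩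

/-- A test for the statement that for all integers `aᵢ` there is an integer `τ` with
`(τ + aᵢ) % Mᵢ ≤ Lᵢ` for all `i`. Here `K * M₃` is a common multiple of the `Mᵢ`. -/
def hitCheck (M₀ L₀ M₁ L₁ M₂ L₂ M₃ L₃ K : ℕ) : Bool :=
  Nat.ble (spreadSteps L₃).sum L₃ &&
  (fun G₀ G₁ G₂ l => forallBelow (fun c => forallBelow (fun d =>
      shiftCheck (Nat.land G₀ (Nat.land (Nat.shiftRight G₁ c) (Nat.shiftRight G₂ d))) l M₃ K)
      M₂) (Nat.gcd M₀ M₁))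
    (progMask M₀ L₀ (2 * K * M₃ / M₀)) (progMask M₁ L₁ (2 * K * M₃ / M₁))
    (progMask M₂ L₂ (2 * K * M₃ / M₂)) (spreadSteps L₃)

/-- Translating time normalizes `a₀` to 0, by the Chinese remainder theorem `a₁` to its offset from
`a₀` modulo `gcd M₀ M₁`, and leaves `a₂` modulo `M₂`. All residues of `a₃` are treated at once by
the masks. -/
theorem exists_of_hitCheck {M₀ L₀ M₁ L₁ M₂ L₂ M₃ L₃ K : ℕ} (h0 : 0 < M₀) (h2 : 0 < M₂)
    (h3 : 0 < M₃) (h : hitCheck M₀ L₀ M₁ L₁ M₂ L₂ M₃ L₃ K = true) (a₀ a₁ a₂ a₃ : ℤ) :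
    ∃ τ : ℤ, (τ + a₀) % M₀ ≤ L₀ ∧ (τ + a₁) % M₁ ≤ L₁ ∧ (τ + a₂) % M₂ ≤ L₂ ∧
      (τ + a₃) % M₃ ≤ L₃ := by
  obtain ⟨hl, h⟩ := Bool.and_eq_true_iff.1 h
  have hl' := Nat.le_of_ble_eq_true hl
  set C := Nat.gcd M₀ M₁ with hC
  have hC0 : 0 < C := Nat.gcd_pos_of_pos_left _ h0
  obtain ⟨c, hc⟩ := Int.eq_ofNat_of_zero_le (Int.emod_nonneg (a₁ - a₀) (b := C) (by omega))
  have hcC : c < C := by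
    have := Int.emod_lt_of_pos (a₁ - a₀) (b := C) (by omega)
    omega
  have hcq := Int.mul_ediv_add_emod (a₁ - a₀) C
  set q := (a₁ - a₀) / C
  have hbez := Nat.gcd_eq_gcd_ab M₀ M₁
  rw [← hC] at hbez
  set X := Nat.gcdA M₀ M₁
  set Y := Nat.gcdB M₀ M₁
  -- By Bézout, this shift turns `a₀` into 0 modulo `M₀` and `a₁` into `c` modulo `M₁`.
  set s : ℤ := - a₀ - q * X * M₀ with hs
  obtain ⟨d, hd⟩ := Int.eq_ofNat_of_zero_le (Int.emod_nonneg (s + a₂) (b := M₂) (by omega))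
  have hdM : d < M₂ := by
    have := Int.emod_lt_of_pos (s + a₂) (b := M₂) (by omega)
    omega
  obtain ⟨e, he⟩ := Int.eq_ofNat_of_zero_le (Int.emod_nonneg (-(s + a₃)) (b := M₃) (by omega))
  have heM : e < M₃ := by
    have := Int.emod_lt_of_pos (-(s + a₃)) (b := M₃) (by omega)
    omega
  obtain ⟨i, δ, hδ, hF⟩ := exists_testBit_of_shiftCheck
    (forallBelow_apply (forallBelow_apply h c hcC) d hdM) heM
  replace hF : (progMask M₀ L₀ (2 * K * M₃ / M₀) &&& (progMask M₁ L₁ (2 * K * M₃ / M₁) >>> c &&&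
    progMask M₂ L₂ (2 * K * M₃ / M₂) >>> d)).testBit (i * M₃ + e + δ) = true := hF
  simp only [Nat.testBit_and, Nat.testBit_shiftRight, Bool.and_eq_true] at hF
  obtain ⟨hF0, hF1, hF2⟩ := hF
  replace hF0 := mod_le_of_testBit_progMask hF0
  replace hF1 := mod_le_of_testBit_progMask hF1
  replace hF2 := mod_le_of_testBit_progMask hF2
  set j := i * M₃ + e + δ with hj
  refine ⟨j + s, ?_, ?_, ?_, ?_⟩
  · rw [show (j : ℤ) + s + a₀ = j + M₀ * (-(q * X)) by rw [hs]; ring, Int.add_mul_emod_self_left]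
    exact_mod_cast hF0
  · rw [show (j : ℤ) + s + a₁ = (c + j : ℕ) + M₁ * (q * Y) by
      push_cast
      rw [hs]
      linear_combination hc - hcq + q * hbez, Int.add_mul_emod_self_left]
    exact_mod_cast hF1
  · have := Int.mul_ediv_add_emod (s + a₂) M₂
    rw [show (j : ℤ) + s + a₂ = (d + j : ℕ) + M₂ * ((s + a₂) / M₂) by
      push_cast
      linear_combination hd - this, Int.add_mul_emod_self_left]
    exact_mod_cast hF2
  · have := Int.mul_ediv_add_emod (-(s + a₃)) M₃
    rw [show (j : ℤ) + s + a₃ = (δ : ℤ) + M₃ * (i - (-(s + a₃)) / M₃) by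
      rw [hj]
      push_cast
      linear_combination this - he, Int.add_mul_emod_self_left]
    exact_mod_cast (Nat.mod_le δ M₃).trans (hδ.trans hl')

/-! ### Certificates for the sporadic and tight speeds -/

/-- The conditions of `covers_of_grid` for `ρ = 599 / 1000` and the largest possible `L`. -/
def looseCheck (x y z w N : ℕ) : Bool :=
  (fun M L => Nat.ble 1 N && ([x, y, z, w].all fun v =>
      Nat.beq (v * M v) N && Nat.ble (1000 * ((L v + 1) * v)) (599 * N)) &&
    hitCheck (M y) (L y) (M z) (L z) (M w) (L w) (M x) (L x) x)
  (fun v => N / v) (fun v => 599 * N / (1000 * v) - 1)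

theorem covers_of_looseCheck {x y z w N : ℕ} (h : looseCheck x y z w N = true) :
    Covers ![(x : ℝ), y, z, w] fun _ => 599 / 1000 := by
  simp only [looseCheck, Bool.and_eq_true, List.all_cons, List.all_nil, Nat.ble_eq, Nat.beq_eq,
    and_true] at h
  obtain ⟨⟨hN, ⟨hx, hx'⟩, ⟨hy, hy'⟩, ⟨hz, hz'⟩, hw, hw'⟩, h⟩ := h
  have pos : ∀ v, v * (N / v) = N → 0 < N / v := fun v hv =>
    Nat.pos_of_mul_pos_left (by rw [hv]; exact hN)
  have key := covers_of_grid (v := ![x, y, z, w]) (M := ![N / x, N / y, N / z, N / w])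
    (L := ![599 * N / (1000 * x) - 1, 599 * N / (1000 * y) - 1, 599 * N / (1000 * z) - 1,
      599 * N / (1000 * w) - 1]) (ρ := 599 / 1000) hN
    (fun i => by fin_cases i <;> assumption)
    (fun i => by
      have cast : ∀ l v : ℕ, 1000 * ((l + 1) * v) ≤ 599 * N →
          ((l : ℝ) + 1) * v ≤ 599 / 1000 * N := fun l v hlv => by
        have : 1000 * (((l : ℝ) + 1) * v) ≤ 599 * N := by exact_mod_cast hlv
        linarith
      fin_cases i
      exacts [cast _ _ hx', cast _ _ hy', cast _ _ hz', cast _ _ hw'])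
    (fun a => by
      obtain ⟨τ, h0, h1, h2, h3⟩ := exists_of_hitCheck (pos y hy) (pos w hw) (pos x hx) h
        (a 1) (a 2) (a 3) (a 0)
      refine ⟨τ, fun i => ?_⟩
      fin_cases i
      exacts [h3, h0, h1, h2])
  refine (show (fun i => ((![x, y, z, w] : Fin 4 → ℕ) i : ℝ)) = ![(x : ℝ), y, z, w] from ?_) ▸ key
  ext i
  fin_cases i <;> rfl

/-- The conditions of `covers_of_refined_grid` for `ρ = 3 / 5`. -/
def tightCheck (x y z w N : ℕ) : Bool :=
  (fun M P => Nat.ble 1 N && ([x, y, z, w].all fun v =>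
      Nat.beq (v * M v) N && Nat.ble (5 * P v) (3 * M v)) &&
    hitCheck (4 * M y) (4 * P y) (4 * M z) (4 * P z) (4 * M w) (4 * P w) (4 * M x) (4 * P x) x)
  (fun v => N / v) (fun v => 3 * (N / v) / 5)

theorem covers_of_tightCheck {x y z w N : ℕ} (h : tightCheck x y z w N = true) :
    Covers ![(x : ℝ), y, z, w] fun _ => 3 / 5 := by
  simp only [tightCheck, Bool.and_eq_true, List.all_cons, List.all_nil, Nat.ble_eq, Nat.beq_eq,
    and_true] at h
  obtain ⟨⟨hN, ⟨hx, hx'⟩, ⟨hy, hy'⟩, ⟨hz, hz'⟩, hw, hw'⟩, h⟩ := h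
  have pos : ∀ v, v * (N / v) = N → 0 < 4 * (N / v) := fun v hv =>
    Nat.mul_pos (by norm_num) (Nat.pos_of_mul_pos_left (by rw [hv]; exact hN))
  have key := covers_of_refined_grid (v := ![x, y, z, w]) (M := ![N / x, N / y, N / z, N / w])
    (P := ![3 * (N / x) / 5, 3 * (N / y) / 5, 3 * (N / z) / 5, 3 * (N / w) / 5]) (ρ := 3 / 5) hN
    (fun i => by fin_cases i <;> assumption)
    (fun i => by
      have cast : ∀ p m : ℕ, 5 * p ≤ 3 * m → (p : ℝ) ≤ 3 / 5 * m := fun p m hpm => by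
        have : 5 * (p : ℝ) ≤ 3 * m := by exact_mod_cast hpm
        linarith
      fin_cases i
      exacts [cast _ _ hx', cast _ _ hy', cast _ _ hz', cast _ _ hw'])
    (fun a => by
      obtain ⟨τ, h0, h1, h2, h3⟩ := exists_of_hitCheck (pos y hy) (pos w hw) (pos x hx) h
        (a 1) (a 2) (a 3) (a 0)
      refine ⟨τ, fun i => ?_⟩
      fin_cases i
      exacts [h3, h0, h1, h2])
  refine (show (fun i => ((![x, y, z, w] : Fin 4 → ℕ) i : ℝ)) = ![(x : ℝ), y, z, w] from ?_) ▸ key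
  ext i
  fin_cases i <;> rfl

/-- The conditions of `not_covers_of_grid` for all `ρ < 3 / 5`, with starting points
`a / M x`, … -/
def gapCheck (x y z w N a b c d : ℕ) : Bool :=
  (fun M => Nat.ble 1 N && ([x, y, z, w].all fun v => Nat.beq (v * M v) N) &&
    forallBelow (fun τ => Nat.ble (3 * M x) (5 * ((τ + a) % M x)) ||
      (Nat.ble (3 * M y) (5 * ((τ + b) % M y)) || (Nat.ble (3 * M z) (5 * ((τ + c) % M z)) ||
        Nat.ble (3 * M w) (5 * ((τ + d) % M w))))) N) (fun v => N / v)

theorem not_covers_of_gapCheck {x y z w N a b c d : ℕ} (h : gapCheck x y z w N a b c d = true)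
    {ρ : ℝ} (hρ : ρ < 3 / 5) : ¬ Covers ![(x : ℝ), y, z, w] fun _ => ρ := by
  simp only [gapCheck, Bool.and_eq_true, List.all_cons, List.all_nil, Nat.ble_eq, Nat.beq_eq,
    and_true] at h
  obtain ⟨⟨hN, hx, hy, hz, hw⟩, h⟩ := h
  have pos : ∀ v, v * (N / v) = N → 0 < N / v := fun v hv =>
    Nat.pos_of_mul_pos_left (by rw [hv]; exact hN)
  -- `(3 * m + 4) / 5` is the ceiling of `3 * m / 5`, so it exceeds `ρ * m` for every `ρ < 3 / 5`.
  have ceil : ∀ m r : ℕ, 3 * m ≤ 5 * r → (3 * m + 4) / 5 ≤ r := fun m r hmr => by omega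
  have key := not_covers_of_grid (v := ![x, y, z, w]) (M := ![N / x, N / y, N / z, N / w])
    (P := ![(3 * (N / x) + 4) / 5, (3 * (N / y) + 4) / 5, (3 * (N / z) + 4) / 5,
      (3 * (N / w) + 4) / 5]) (a := ![a, b, c, d]) (ρ := ρ) hN
    (fun i => by fin_cases i <;> assumption)
    (fun i => by
      have cast : ∀ m : ℕ, 0 < m → ρ * m < ((3 * m + 4) / 5 : ℕ) := fun m hm => by
        have h1 : 3 * m ≤ 5 * ((3 * m + 4) / 5) := by omega
        have h2 : 3 * (m : ℝ) ≤ 5 * ((3 * m + 4) / 5 : ℕ) := by exact_mod_cast h1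
        have h3 : (0 : ℝ) < m := by exact_mod_cast hm
        nlinarith
      fin_cases i
      exacts [cast _ (pos x hx), cast _ (pos y hy), cast _ (pos z hz), cast _ (pos w hw)])
    (fun τ hτ => by
      have := forallBelow_apply h τ hτ
      simp only [Bool.or_eq_true, Nat.ble_eq] at this
      rcases this with h | h | h | h
      exacts [⟨0, ceil _ _ h⟩, ⟨1, ceil _ _ h⟩, ⟨2, ceil _ _ h⟩, ⟨3, ceil _ _ h⟩])
  refine (show (fun i => ((![x, y, z, w] : Fin 4 → ℕ) i : ℝ)) = ![(x : ℝ), y, z, w] from ?_) ▸ key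
  ext i
  fin_cases i <;> rfl

/-! ### Kernel evaluations -/

theorem looseCheck_sporadic :
    (sporadic.all fun e => looseCheck e.1 e.2.1 e.2.2.1 e.2.2.2.1 e.2.2.2.2) = true := by
  decide +kernel

theorem tightCheck_one_two_three_four : tightCheck 1 2 3 4 60 = true := by decide +kernel

theorem tightCheck_one_three_four_six : tightCheck 1 3 4 6 60 = true := by decide +kernel

theorem tightCheck_one_three_four_seven : tightCheck 1 3 4 7 420 = true := by decide +kernel

theorem gapCheck_one_two_three_four : gapCheck 1 2 3 4 60 36 10 2 0 = true := by decide +kernel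

theorem gapCheck_one_three_four_six : gapCheck 1 3 4 6 60 55 2 4 0 = true := by decide +kernel

theorem gapCheck_one_three_four_seven : gapCheck 1 3 4 7 420 225 4 78 0 = true := by
  decide +kernel

/-- Tests all first speeds `x` with `a < x ≤ b`. -/
def checkRange (a b : ℕ) : Bool :=
  forallBelow (fun x => Nat.ble x a || checkFirst x) (Nat.succ b)

theorem checkFirst_of_checkRange {a b x : ℕ} (h : checkRange a b = true) (ha : a < x)
    (hb : x ≤ b) : checkFirst x = true :=
  (Bool.or_eq_true_iff.1 (forallBelow_apply h x (Nat.lt_succ_of_le hb))).resolve_left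
    fun hle => absurd (Nat.le_of_ble_eq_true hle) (by omega)

theorem checkRange_upTo_one : checkRange 0 1 = true := by decide +kernel

theorem checkRange_upTo_two : checkRange 1 2 = true := by decide +kernel

theorem checkRange_upTo_four : checkRange 2 4 = true := by decide +kernel

theorem checkRange_upTo_seven : checkRange 4 7 = true := by decide +kernel

theorem checkRange_upTo_eleven : checkRange 7 11 = true := by decide +kernel

theorem checkRange_upTo_sixteen : checkRange 11 16 = true := by decide +kernel

theorem checkRange_upTo_twenty_three : checkRange 16 23 = true := by decide +kernel

theorem checkRange_upTo_forty_eight : checkRange 23 48 = true := by decide +kernel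

theorem checkFirst_eq_true {x : ℕ} (hx : 0 < x) (hx' : x ≤ 48) : checkFirst x = true := by
  rcases le_or_gt x 1 with h1 | h1
  · exact checkFirst_of_checkRange checkRange_upTo_one (by omega) h1
  rcases le_or_gt x 2 with h2 | h2
  · exact checkFirst_of_checkRange checkRange_upTo_two (by omega) h2
  rcases le_or_gt x 4 with h4 | h4
  · exact checkFirst_of_checkRange checkRange_upTo_four (by omega) h4
  rcases le_or_gt x 7 with h7 | h7
  · exact checkFirst_of_checkRange checkRange_upTo_seven (by omega) h7
  rcases le_or_gt x 11 with h11 | h11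
  · exact checkFirst_of_checkRange checkRange_upTo_eleven (by omega) h11
  rcases le_or_gt x 16 with h16 | h16
  · exact checkFirst_of_checkRange checkRange_upTo_sixteen (by omega) h16
  rcases le_or_gt x 23 with h23 | h23
  · exact checkFirst_of_checkRange checkRange_upTo_twenty_three (by omega) h23
  exact checkFirst_of_checkRange checkRange_upTo_forty_eight h23 hx'

/-! ### Conclusion -/

theorem covers_or_isTight {x y z w : ℕ} (hx : 0 < x) (hxy : x < y) (hyz : y < z) (hzw : z < w)
    (hg : Nat.gcd (Nat.gcd (Nat.gcd x y) z) w = 1) (hsum : x + y + z + w ≤ 195) :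
    (Covers ![(x : ℝ), y, z, w] fun _ => 599 / 1000) ∨ isTight x y z w = true := by
  -- Distinct increasing speeds with sum at most 195 force `4 * x + 6 ≤ 195`, hence `x ≤ 48`.
  rcases covers_of_checkFirst hx hxy hyz hzw hsum hg (checkFirst_eq_true hx (by omega))
    with h | h
  · exact .inl h
  rcases Bool.or_eq_true_iff.1 h with h | h
  · exact .inr h
  obtain ⟨e, he, h⟩ := List.any_eq_true.1 h
  simp only [Bool.and_eq_true, Nat.beq_eq] at h
  obtain ⟨rfl, rfl, rfl, rfl⟩ := h
  exact .inl (covers_of_looseCheck (List.all_eq_true.1 looseCheck_sporadic e he))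

theorem isTight_iff {x y z w : ℕ} : isTight x y z w = true ↔
    (x = 1 ∧ y = 2 ∧ z = 3 ∧ w = 4) ∨ (x = 1 ∧ y = 3 ∧ z = 4 ∧ w = 6) ∨
      (x = 1 ∧ y = 3 ∧ z = 4 ∧ w = 7) := by
  simp only [isTight, Bool.and_eq_true, Bool.or_eq_true, Nat.beq_eq]
  tauto

theorem covers_of_isTight {x y z w : ℕ} (h : isTight x y z w = true) :
    Covers ![(x : ℝ), y, z, w] fun _ => 3 / 5 := by
  rcases isTight_iff.1 h with ⟨rfl, rfl, rfl, rfl⟩ | ⟨rfl, rfl, rfl, rfl⟩ | ⟨rfl, rfl, rfl, rfl⟩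
  exacts [covers_of_tightCheck tightCheck_one_two_three_four,
    covers_of_tightCheck tightCheck_one_three_four_six,
    covers_of_tightCheck tightCheck_one_three_four_seven]

theorem not_covers_of_isTight {x y z w : ℕ} (h : isTight x y z w = true) {ρ : ℝ}
    (hρ : ρ < 3 / 5) : ¬ Covers ![(x : ℝ), y, z, w] fun _ => ρ := by
  rcases isTight_iff.1 h with ⟨rfl, rfl, rfl, rfl⟩ | ⟨rfl, rfl, rfl, rfl⟩ | ⟨rfl, rfl, rfl, rfl⟩
  exacts [not_covers_of_gapCheck gapCheck_one_two_three_four hρ,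
    not_covers_of_gapCheck gapCheck_one_three_four_six hρ,
    not_covers_of_gapCheck gapCheck_one_three_four_seven hρ]

/-- Covering at `599 / 1000` pushes the infimum strictly below `3 / 5`; for the tight speeds `3 / 5`
is the least covering dilation. -/
theorem coveringRadius_eq_iff {x y z w : ℕ} (hx : 0 < x) (hxy : x < y) (hyz : y < z) (hzw : z < w)
    (hg : Nat.gcd (Nat.gcd (Nat.gcd x y) z) w = 1) (hsum : x + y + z + w ≤ 195)
    {Z : Set (Fin 3 → ℝ)}
    (hZ : ∀ ρ : ℝ, 0 < ρ → (ρ ∈ coveringDilations Z ↔ Covers ![(x : ℝ), y, z, w] fun _ => ρ)) :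
    coveringRadius Z = 3 / 5 ↔ isTight x y z w = true := by
  constructor
  · intro h
    refine (covers_or_isTight hx hxy hyz hzw hg hsum).resolve_left fun hc => ?_
    have h1 : coveringRadius Z ≤ 599 / 1000 :=
      csInf_le ⟨0, fun ρ hρ => hρ.1.le⟩ ((hZ _ (by norm_num)).2 hc)
    rw [h] at h1
    norm_num at h1
  · intro h
    refine IsLeast.csInf_eq ⟨(hZ _ (by norm_num)).2 (covers_of_isTight h), fun ρ hρ => ?_⟩
    by_contra! hlt
    exact not_covers_of_isTight h hlt ((hZ ρ hρ.1).1 hρ)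

theorem isLRGenerators_of_volumeVector_ne_zero {u : Fin 4 → Fin 3 → ℤ}
    (h : ∀ i, volumeVector u i ≠ 0) : IsLRGenerators u := fun i => by
  refine Matrix.linearIndependent_rows_of_det_ne_zero
    (A := Matrix.of fun j : Fin 3 => intVec (u (i.succAbove j))) fun h0 => h i ?_
  have : ((Matrix.of fun j : Fin 3 => u (i.succAbove j)).det : ℝ) = 0 := by
    rw [← h0]
    simp [Matrix.det_fin_three, intVec]
  rw [volumeVector, abs_eq_zero]
  exact_mod_cast this

theorem isSLRGenerators_of_volumeVector_eq {u : Fin 4 → Fin 3 → ℤ} {v : Fin 4 → ℤ}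
    (hu : volumeVector u = v) (h0 : ∀ i, v i ≠ 0) (hv : Function.Injective v) :
    IsSLRGenerators u ∧ volumeVector u = v :=
  ⟨⟨isLRGenerators_of_volumeVector_ne_zero (hu ▸ h0), hu ▸ hv⟩, hu⟩

theorem theorem4p2 :
    (∀ v : Fin 4 → ℤ, 1 ≤ v 0 → v 0 < v 1 → v 1 < v 2 → v 2 < v 3 →
      Finset.univ.gcd v = 1 → v 0 + v 1 + v 2 + v 3 ≤ 195 →
      ∀ Z : Set (Fin 3 → ℝ), IsSLRZonotope v Z →
        (coveringRadius Z = 3 / 5 ↔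
          v = ![1, 2, 3, 4] ∨ v = ![1, 3, 4, 6] ∨ v = ![1, 3, 4, 7])) ∧
    (IsSLRGenerators ![![1, -1, 1], ![0, 1, 1], ![1, 1, -1], ![-1, -1, 0]] ∧
      volumeVector ![![1, -1, 1], ![0, 1, 1], ![1, 1, -1], ![-1, -1, 0]] = ![1, 2, 3, 4]) ∧
    (IsSLRGenerators ![![1, 1, 2], ![1, -1, 0], ![-1, -1, 1], ![0, 1, -1]] ∧
      volumeVector ![![1, 1, 2], ![1, -1, 0], ![-1, -1, 1], ![0, 1, -1]] = ![1, 3, 4, 6]) ∧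
    (IsSLRGenerators ![![1, 0, 2], ![1, -1, -2], ![-1, -1, 1], ![0, 1, 0]] ∧
      volumeVector ![![1, 0, 2], ![1, -1, -2], ![-1, -1, 1], ![0, 1, 0]] = ![1, 3, 4, 7]) := by
  refine ⟨?_, ?_, ?_, ?_⟩
  · rintro v h0 h1 h2 h3 hg hsum Z ⟨c, u, -, rfl, rfl⟩
    have hZ := fun (ρ : ℝ) (hρ : 0 < ρ) => mem_coveringDilations_zonotope hg c hρ
    generalize volumeVector u = v at *
    obtain ⟨x, hx⟩ := Int.eq_ofNat_of_zero_le (show 0 ≤ v 0 by omega)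
    obtain ⟨y, hy⟩ := Int.eq_ofNat_of_zero_le (show 0 ≤ v 1 by omega)
    obtain ⟨z, hz⟩ := Int.eq_ofNat_of_zero_le (show 0 ≤ v 2 by omega)
    obtain ⟨w, hw⟩ := Int.eq_ofNat_of_zero_le (show 0 ≤ v 3 by omega)
    obtain rfl : v = ![(x : ℤ), y, z, w] := by
      ext i
      fin_cases i <;> assumption
    simp only [Matrix.cons_val] at h0 h1 h2 h3 hsum
    have hgcd : Nat.gcd (Nat.gcd (Nat.gcd x y) z) w = 1 := by
      have hd : ((Nat.gcd (Nat.gcd (Nat.gcd x y) z) w : ℕ) : ℤ) ∣ 1 := by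
        rw [← hg]
        refine Finset.dvd_gcd fun i _ => ?_
        have d3 := Nat.gcd_dvd_left (Nat.gcd (Nat.gcd x y) z) w
        have d2 := d3.trans (Nat.gcd_dvd_left (Nat.gcd x y) z)
        fin_cases i
        exacts [Int.natCast_dvd_natCast.2 (d2.trans (Nat.gcd_dvd_left _ _)),
          Int.natCast_dvd_natCast.2 (d2.trans (Nat.gcd_dvd_right _ _)),
          Int.natCast_dvd_natCast.2 (d3.trans (Nat.gcd_dvd_right _ _)),
          Int.natCast_dvd_natCast.2 (Nat.gcd_dvd_right _ _)]
      exact Nat.dvd_one.1 (by exact_mod_cast hd)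
    have hcast : (fun i => ((![(x : ℤ), y, z, w] : Fin 4 → ℤ) i : ℝ)) = ![(x : ℝ), y, z, w] := by
      ext i
      fin_cases i <;> simp
    rw [hcast] at hZ
    rw [coveringRadius_eq_iff (by omega) (by omega) (by omega) (by omega) hgcd (by omega) hZ,
      isTight_iff]
    have hvec : ∀ a b c d : ℕ, (x = a ∧ y = b ∧ z = c ∧ w = d) ↔
        ![(x : ℤ), y, z, w] = ![(a : ℤ), b, c, d] := fun a b c d => by
      simp
    rw [hvec, hvec, hvec]
    rfl
  all_goals
    refine isSLRGenerators_of_volumeVector_eq ?_ (by decide) (by decide)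
    ext i
    fin_cases i <;> simp [volumeVector, Matrix.det_fin_three, Fin.succAbove, Fin.lt_def]
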